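/- Let $X$ be a finite set and $R_0,\dots,R_d$ nonempty symmetric relations on $X$ forming a symmetric association scheme with $d$ classes: the adjacency matrices satisfy $A_0=I$, $\sum_i A_i=J$ (the all ones matrix), and every $A_iA_j$ is a linear combination of $A_0,\dots,A_d$. The scheme is imprimitive if some graph $(X,R_i)$ with $1\le i\le d$ is disconnected. Let $E_0=\frac1{|X|}J,E_1,\dots,E_d$ be an ordering of the primitive idempotents of $\mathrm{span}(A_0,\dots,A_d)$. Define $Q_{ji}$ and $q_{ij}^h$ by $E_i=\frac1{|X|}\sum_j Q_{ji}A_j$ and $E_i\circ E_j=\frac1{|X|}\sum_h q_{ij}^hE_h$, where $\circ$ is the entrywise product. Put $m=Q_{01}$ (the first multiplicity), $a_i^*=q_{1,i}^i$, $b_i^*=q_{1,i+1}^i$, $c_i^*=q_{1,i-1}^i$, with $b_d^*=c_0^*=0$. The scheme is cometric ($Q$-polynomial) with respect to the ordering if for each $0\le i\le d$ there is a polynomial $v_i^*$ of degree $i$ with $Q_{ji}=v_i^*(Q_{j1})$ for $0\le j\le d$. Theorem. Suppose that the scheme is imprimitive, that it is cometric with respect to the ordering $E_0,\dots,E_d$,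 and that $m>2$. Then: 1. It is not the case that $d=6$, the Krein array has the form $$\{b_0^*,\dots,b_5^*;\,c_1^*,\dots,c_6^*\}=\{m,\,m-1,\,1,\,b_3^*,\,b_4^*,\,1;\ 1,\,c_2^*,\,m-b_3^*,\,1,\,c_5^*,\,m\},$$ and $a_2^*=a_4^*+a_5^*$. 2. In particular, the scheme is $Q$-bipartite, that is, $a_i^*=0$ for $0\le i\le d$, or $Q$-antipodal, that is, $b_i^*=c_{d-i}^*$ for $0\le i\le d$ except possibly $i=\lfloor d/2\rfloor$. -/

import Mathlib

open Matrix

noncomputable section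

open Classical in
/-- The adjacency matrix over `ℝ` of a binary relation on `X`. -/
def relMatrix {X : Type*} (r : X → X → Prop) : Matrix X X ℝ :=
  Matrix.of fun x y => if r x y then 1 else 0

/-- The all ones matrix `J`. -/
def allOnes (X : Type*) : Matrix X X ℝ := Matrix.of fun _ _ => 1

/-- A symmetric association scheme with `d` classes on the finite set `X`: nonempty symmetric
relations `R 0, …, R d` whose adjacency matrices satisfy (AS1), (AS2), (AS3). -/
structure SymAssocScheme (X : Type*) [Fintype X] [DecidableEq X] (d : ℕ) where
  /-- the relations `R₀, …, R_d` -/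
  R : Fin (d + 1) → X → X → Prop
  symm : ∀ i x y, R i x y → R i y x
  nonempty : ∀ i, ∃ x y, R i x y
  as1 : relMatrix (R 0) = 1
  as2 : ∑ i, relMatrix (R i) = allOnes X
  as3 : ∀ i j, relMatrix (R i) * relMatrix (R j) ∈
    Submodule.span ℝ (Set.range fun h => relMatrix (R h))

namespace SymAssocScheme

variable {X : Type*} [Fintype X] [DecidableEq X] {d : ℕ}

/-- The adjacency matrix `A_i`. -/
def A (S : SymAssocScheme X d) (i : Fin (d + 1)) : Matrix X X ℝ := relMatrix (S.R i)

/-- The Bose–Mesner algebra, as the real span of `A_0, …, A_d`. -/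
def boseMesner (S : SymAssocScheme X d) : Submodule ℝ (Matrix X X ℝ) :=
  Submodule.span ℝ (Set.range S.A)

/-- The graph `(X, R_i)`; for `i ≠ 0` the relation `R_i` is irreflexive, so that the clause `x ≠ y`
is redundant there. -/
def graph (S : SymAssocScheme X d) (i : Fin (d + 1)) : SimpleGraph X where
  Adj x y := x ≠ y ∧ S.R i x y
  symm := ⟨fun x y h => ⟨h.1.symm, S.symm i x y h.2⟩⟩
  loopless := ⟨fun _ h => h.1 rfl⟩

/-- Primitive: all the graphs `(X, R_i)` with `1 ≤ i ≤ d` are connected. -/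
def IsPrimitive (S : SymAssocScheme X d) : Prop := ∀ i, i ≠ 0 → (S.graph i).Connected

/-- Imprimitive: not primitive. -/
def IsImprimitive (S : SymAssocScheme X d) : Prop := ¬ S.IsPrimitive

/-- An ordering `E_0 = |X|⁻¹ J, E_1, …, E_d` of the primitive idempotents of the Bose–Mesner
algebra: `d + 1` nonzero pairwise orthogonal idempotents summing to `I` in this algebra of
dimension `d + 1` (they are then a basis of it, see `basisE`). -/
structure IdempotentOrdering (S : SymAssocScheme X d) where
  E : Fin (d + 1) → Matrix X X ℝ
  mem : ∀ i, E i ∈ S.boseMesner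
  ne_zero : ∀ i, E i ≠ 0
  zero_eq : E 0 = (Fintype.card X : ℝ)⁻¹ • allOnes X
  mul_eq : ∀ i j, E i * E j = if i = j then E i else 0
  sum_eq : ∑ i, E i = 1

theorem A_apply_of_rel (S : SymAssocScheme X d) {i j : Fin (d + 1)} {x y : X}
    (h : S.R i x y) : S.A j x y = if j = i then 1 else 0 := by
  classical
  have key := congrFun (congrFun S.as2 x) y
  simp only [Matrix.sum_apply, relMatrix, allOnes, Matrix.of_apply] at key
  rw [← Finset.add_sum_erase _ _ (Finset.mem_univ i), if_pos h] at key
  have hz : ∑ k ∈ Finset.univ.erase i, (if S.R k x y then (1 : ℝ) else 0) = 0 := by linarith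
  rw [Finset.sum_eq_zero_iff_of_nonneg (fun k _ => by split_ifs <;> norm_num)] at hz
  by_cases hj : j = i
  · subst hj; simp [A, relMatrix, h]
  · simpa [A, relMatrix, hj] using hz j (by simp [hj])

theorem exists_rel (S : SymAssocScheme X d) (x y : X) : ∃ i, S.R i x y := by
  classical
  by_contra hne
  push Not at hne
  have key := congrFun (congrFun S.as2 x) y
  simp [Matrix.sum_apply, relMatrix, allOnes, hne] at key

theorem linearIndependent_A (S : SymAssocScheme X d) : LinearIndependent ℝ S.A := by
  rw [Fintype.linearIndependent_iff]
  intro g hg i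
  obtain ⟨x, y, h⟩ := S.nonempty i
  have key := congrFun (congrFun hg x) y
  simpa [Matrix.sum_apply, S.A_apply_of_rel h] using key

/-- `A_0, …, A_d` as a basis of the Bose–Mesner algebra. -/
def basisA (S : SymAssocScheme X d) : Module.Basis (Fin (d + 1)) ℝ S.boseMesner :=
  Module.Basis.span S.linearIndependent_A

theorem hadamard_A (S : SymAssocScheme X d) (i j : Fin (d + 1)) :
    S.A i ⊙ S.A j = if i = j then S.A i else 0 := by
  ext x y
  obtain ⟨k, hk⟩ := S.exists_rel x y
  rw [Matrix.hadamard_apply, S.A_apply_of_rel hk, S.A_apply_of_rel hk]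
  split_ifs <;> simp_all [S.A_apply_of_rel hk]

theorem hadamard_mem (S : SymAssocScheme X d) {M N : Matrix X X ℝ}
    (hM : M ∈ S.boseMesner) (hN : N ∈ S.boseMesner) : M ⊙ N ∈ S.boseMesner := by
  induction hM using Submodule.span_induction with
  | zero => simp
  | add a b _ _ ha hb => rw [Matrix.add_hadamard]; exact add_mem ha hb
  | smul c a _ ha => rw [Matrix.smul_hadamard]; exact Submodule.smul_mem _ _ ha
  | mem a ha =>
    obtain ⟨i, rfl⟩ := ha
    induction hN using Submodule.span_induction with
    | zero => simp
    | add a b _ _ ha hb => rw [Matrix.hadamard_add]; exact add_mem ha hb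
    | smul c a _ ha => rw [Matrix.hadamard_smul]; exact Submodule.smul_mem _ _ ha
    | mem b hb =>
      obtain ⟨j, rfl⟩ := hb
      rw [hadamard_A]
      split_ifs
      · exact Submodule.subset_span ⟨i, rfl⟩
      · exact zero_mem _

namespace IdempotentOrdering

variable {S : SymAssocScheme X d}

theorem linearIndependent_E (𝓔 : S.IdempotentOrdering) :
    LinearIndependent ℝ fun i => (⟨𝓔.E i, 𝓔.mem i⟩ : S.boseMesner) := by
  rw [Fintype.linearIndependent_iff]
  intro g hg i
  have h1 : ∑ k, g k • 𝓔.E k = 0 := by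
    simpa using congrArg Subtype.val hg
  have h2 := congrArg (fun M => M * 𝓔.E i) h1
  simp only [Finset.sum_mul, Matrix.smul_mul, 𝓔.mul_eq, Matrix.zero_mul, smul_ite, smul_zero,
    Finset.sum_ite_eq', Finset.mem_univ, if_true] at h2
  exact (smul_eq_zero.mp h2).resolve_right (𝓔.ne_zero i)

/-- `E_0, …, E_d` as a basis of the Bose–Mesner algebra. -/
def basisE (𝓔 : S.IdempotentOrdering) : Module.Basis (Fin (d + 1)) ℝ S.boseMesner :=
  basisOfLinearIndependentOfCardEqFinrank 𝓔.linearIndependent_E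
    (Module.finrank_eq_card_basis S.basisA).symm

/-- The eigenmatrix `Q`, defined by `E_i = |X|⁻¹ ∑_j Q_{ji} A_j`. -/
def Q (𝓔 : S.IdempotentOrdering) : Matrix (Fin (d + 1)) (Fin (d + 1)) ℝ :=
  Matrix.of fun j i => (Fintype.card X : ℝ) * S.basisA.repr ⟨𝓔.E i, 𝓔.mem i⟩ j

/-- The Krein parameters: `krein i j h` is `q_{ij}^h`, defined by
`E_i ∘ E_j = |X|⁻¹ ∑_h q_{ij}^h E_h` with the entrywise product `∘`. -/
def krein (𝓔 : S.IdempotentOrdering) (i j h : Fin (d + 1)) : ℝ :=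
  (Fintype.card X : ℝ) *
    𝓔.basisE.repr ⟨𝓔.E i ⊙ 𝓔.E j, S.hadamard_mem (𝓔.mem i) (𝓔.mem j)⟩ h

theorem card_ne_zero (S : SymAssocScheme X d) : (Fintype.card X : ℝ) ≠ 0 := by
  obtain ⟨x, _⟩ := S.nonempty 0
  have : Nonempty X := ⟨x⟩
  simp

theorem E_eq_sum_A (𝓔 : S.IdempotentOrdering) (i : Fin (d + 1)) :
    𝓔.E i = (Fintype.card X : ℝ)⁻¹ • ∑ j, 𝓔.Q j i • S.A j := by
  have h := congrArg Subtype.val (S.basisA.sum_repr ⟨𝓔.E i, 𝓔.mem i⟩)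
  have hb : ∀ j, ((S.basisA j : S.boseMesner) : Matrix X X ℝ) = S.A j := fun j => by
    exact congrArg Subtype.val (Module.Basis.span_apply S.linearIndependent_A j)
  simp only [Submodule.coe_sum, Submodule.coe_smul, hb] at h
  simp only [Q, Matrix.of_apply, mul_smul, ← Finset.smul_sum, h]
  rw [inv_smul_smul₀ (card_ne_zero S)]

theorem hadamard_E (𝓔 : S.IdempotentOrdering) (i j : Fin (d + 1)) :
    𝓔.E i ⊙ 𝓔.E j = (Fintype.card X : ℝ)⁻¹ • ∑ h, 𝓔.krein i j h • 𝓔.E h := by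
  have h := congrArg Subtype.val
    (𝓔.basisE.sum_repr ⟨𝓔.E i ⊙ 𝓔.E j, S.hadamard_mem (𝓔.mem i) (𝓔.mem j)⟩)
  have hb : ∀ j, ((𝓔.basisE j : S.boseMesner) : Matrix X X ℝ) = 𝓔.E j := fun j => by
    simp [basisE]
  simp only [Submodule.coe_sum, Submodule.coe_smul, hb] at h
  simp only [krein, mul_smul, ← Finset.smul_sum, h]
  rw [inv_smul_smul₀ (card_ne_zero S)]

/-- `q_{ij}^h` with natural number indices, `0` unless `i, j, h ≤ d`. -/
def q (𝓔 : S.IdempotentOrdering) (i j h : ℕ) : ℝ :=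
  if H : i < d + 1 ∧ j < d + 1 ∧ h < d + 1 then
    𝓔.krein ⟨i, H.1⟩ ⟨j, H.2.1⟩ ⟨h, H.2.2⟩
  else 0

/-- The first multiplicity `m = m_1 = Q_{01}` (meant for `d ≥ 1`). -/
def firstMultiplicity (𝓔 : S.IdempotentOrdering) : ℝ := 𝓔.Q 0 1

/-- `a_i^* = q_{1,i}^i`. -/
def a (𝓔 : S.IdempotentOrdering) (i : ℕ) : ℝ := 𝓔.q 1 i i

/-- `b_i^* = q_{1,i+1}^i`, with `b_d^* = 0`. -/
def b (𝓔 : S.IdempotentOrdering) (i : ℕ) : ℝ := 𝓔.q 1 (i + 1) i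

/-- `c_i^* = q_{1,i-1}^i`, with `c_0^* = 0`. -/
def c (𝓔 : S.IdempotentOrdering) (i : ℕ) : ℝ := if i = 0 then 0 else 𝓔.q 1 (i - 1) i

/-- Cometric (`Q`-polynomial) with respect to the ordering: for each `i` there is a polynomial
`v_i^*` of degree `i` with `Q_{ji} = v_i^*(Q_{j1})` for all `j`. (Only for `d = 0` does the index
`1` wrap around, to `0`; a scheme with `d = 0` is primitive.) -/
def IsCometric (𝓔 : S.IdempotentOrdering) : Prop :=
  ∀ i : Fin (d + 1), ∃ v : Polynomial ℝ, v.degree = ((i : ℕ) : WithBot ℕ) ∧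
    ∀ j, 𝓔.Q j i = v.eval (𝓔.Q j 1)

/-- The Krein array `{b_0^*, …, b_{d-1}^*; c_1^*, …, c_d^*}`. -/
def kreinArray (𝓔 : S.IdempotentOrdering) : List ℝ × List ℝ :=
  ((List.range d).map 𝓔.b, (List.range d).map fun i => 𝓔.c (i + 1))

/-- `Q`-bipartite. -/
def IsQBipartite (𝓔 : S.IdempotentOrdering) : Prop := ∀ i ≤ d, 𝓔.a i = 0

/-- `Q`-antipodal. -/
def IsQAntipodal (𝓔 : S.IdempotentOrdering) : Prop :=
  ∀ i ≤ d, i ≠ d / 2 → 𝓔.b i = 𝓔.c (d - i)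

/-- The parameters of the exceptional case with six classes. -/
def IsExceptionalSix (𝓔 : S.IdempotentOrdering) : Prop :=
  d = 6 ∧
  (∃ b₃ b₄ c₂ c₅ : ℝ, 𝓔.kreinArray =
    ([𝓔.firstMultiplicity, 𝓔.firstMultiplicity - 1, 1, b₃, b₄, 1],
     [1, c₂, 𝓔.firstMultiplicity - b₃, 1, c₅, 𝓔.firstMultiplicity])) ∧
  𝓔.a 2 = 𝓔.a 4 + 𝓔.a 5

end IdempotentOrdering

end SymAssocScheme

end

/-!
Write `m = Q_{01}`, `T(i, j, h) = q_{ij}^h m_h`, which is symmetric in `i, j, h`, and call a set `I`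
of indices closed if `q_{ij}^h ≠ 0` with `i, j ∈ I` forces `h ∈ I`.

Let `(X, R_i)` be disconnected and let `I` consist of the `h` for which every function in the image
of `E_h` is constant on its components (`stable`). Then `I` is closed, it contains some
`h` with `1 ≤ h ≤ d` (an eigenvalue argument, `exists_mem_stable`), and it does not contain `1`, as
`E_1` generates everything (`IsCometric.one_notMem_stable`). Let `t` be its least positive element.
Closedness gives `a_t^* = 0`, and `q_{2,t}^t = 0` unless `t = 2`.

* If `t = d`, then `{0, d}` is closed, `E_d ∘ E_i` involves only `E_i` and `E_{d-i}`, and comparing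
  coefficients in `E_d ∘ (E_i ∘ E_1) = (E_d ∘ E_i) ∘ E_1` shows that the scheme is dual antipodal
  (`IsCometric.isQAntipodal`).
* If `t = 2 < d`, then `I` is the set of even indices. Since `E_1` sums to zero and `E_2` is constant
  on components, the entries of `|X| E_1` in a row and a component are zeros of a quadratic
  polynomial; if `a_1^* ≠ 0`, this leaves only three dual eigenvalues. So `a_1^* = 0`, components
  have size two, and all `a_j^*` vanish (`IsCometric.isQBipartite`).
* The case `2 < t < d` does not occur when `m > 2`: if `1 ≤ t < d` and `a_t^* = 0 = q_{2,t}^t`, then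
  `m ≤ 2` (`IsCometric.mult_one_le_two`).

The last statement is the heart of the matter, and it excludes the exceptional case with six classes
as well, with `t = 3`, where the Krein array itself gives `a_3^* = 0` and `q_{2,3}^3 = 0`. Its proof
runs as follows. Let `V_i` be the image of `E_i`, and let `P` be the Gram kernel on `V_1 ⊗ V_t` of
the map `u ⊗ x ↦ E_{t+1} (u ∘ x)`; let `P'` be its partial transpose in the factor `V_1` and `G` the
identity kernel of `V_1 ⊗ V_t`. The inner product `⟨P, P'⟩` is a tetrahedral sum over `X⁴` with
idempotents on the edges (`tetra`); the others are simpler. Such a sum vanishes when the Krein parameter at one of the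
vertices does (the criterion of Cameron, Goethals and Seidel), and summing over the label of one
edge gives a product of two Krein parameters. Because `a_t^* = 0`, these two facts determine
`⟨P, P'⟩` as a multiple of `c_{t+1}^* - c_t^*`; because also `q_{2,t}^t = 0`, they give
`c_{t+1}^* = 1`. Then `‖|X| (P + P') - (2 b_t^* / m) G‖² ≥ 0` becomes `c_t^* (2 - m) ≥ 0`.
-/

noncomputable section

namespace SymAssocScheme

variable {X : Type*} [Fintype X] [DecidableEq X] {d : ℕ}

/-- The order `|X|` as a real number. -/
local notation "𝐍" => (Fintype.card X : ℝ)

/-! ### Idempotents, multiplicities and Krein parameters -/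

theorem boseMesner_apply_comm (S : SymAssocScheme X d) {M : Matrix X X ℝ}
    (hM : M ∈ S.boseMesner) (x y : X) : M x y = M y x := by
  induction hM using Submodule.span_induction with
  | zero => simp
  | add a b _ _ ha hb => simp [ha, hb]
  | smul c a _ ha => simp [ha]
  | mem a ha =>
    classical
    obtain ⟨i, rfl⟩ := ha
    have h : S.R i x y ↔ S.R i y x := ⟨S.symm i x y, S.symm i y x⟩
    simp only [A, relMatrix, Matrix.of_apply]
    by_cases hxy : S.R i x y
    · rw [if_pos hxy, if_pos (h.mp hxy)]
    · rw [if_neg hxy, if_neg (fun hc => hxy (h.mpr hc))]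

namespace IdempotentOrdering

variable {S : SymAssocScheme X d} (𝓔 : S.IdempotentOrdering)

/-- The primitive idempotent `E_i` with a natural number index, `0` for `i > d`. -/
def idem (i : ℕ) : Matrix X X ℝ := if h : i < d + 1 then 𝓔.E ⟨i, h⟩ else 0

/-- The multiplicity `m_i`, the rank of `E_i`, encoded as its trace. -/
def mult (i : ℕ) : ℝ := (𝓔.idem i).trace

theorem idem_of_lt {i : ℕ} (h : i < d + 1) : 𝓔.idem i = 𝓔.E ⟨i, h⟩ := dif_pos h

theorem idem_val (i : Fin (d + 1)) : 𝓔.idem i = 𝓔.E i := 𝓔.idem_of_lt i.2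

theorem idem_of_gt {i : ℕ} (h : d < i) : 𝓔.idem i = 0 := dif_neg (by omega)

theorem idem_mem (i : ℕ) : 𝓔.idem i ∈ S.boseMesner := by
  unfold idem; split_ifs
  · exact 𝓔.mem _
  · exact zero_mem _

theorem idem_comm (i : ℕ) (x y : X) : 𝓔.idem i x y = 𝓔.idem i y x :=
  S.boseMesner_apply_comm (𝓔.idem_mem i) x y

theorem idem_mul_idem (i j : ℕ) :
    𝓔.idem i * 𝓔.idem j = if i = j then 𝓔.idem i else 0 := by
  by_cases hi : i < d + 1
  · by_cases hj : j < d + 1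
    · rw [𝓔.idem_of_lt hi, 𝓔.idem_of_lt hj, 𝓔.mul_eq]; simp [Fin.ext_iff]
    · rw [𝓔.idem_of_gt (i := j) (by omega), if_neg (by omega)]; simp
  · rw [𝓔.idem_of_gt (i := i) (by omega)]; simp

theorem sum_idem : ∑ i ∈ Finset.range (d + 1), 𝓔.idem i = 1 := by
  rw [← 𝓔.sum_eq, Finset.sum_range]
  exact Finset.sum_congr rfl fun i _ => 𝓔.idem_val i

theorem idem_zero_apply (x y : X) : 𝓔.idem 0 x y = 𝐍⁻¹ := by
  rw [𝓔.idem_of_lt (Nat.succ_pos d)]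
  have : (⟨0, Nat.succ_pos d⟩ : Fin (d + 1)) = 0 := rfl
  rw [this, 𝓔.zero_eq]; simp [allOnes]

theorem q_of_gt_left {i : ℕ} (h : d < i) (j k : ℕ) : 𝓔.q i j k = 0 := dif_neg (by omega)

theorem q_of_gt_mid {j : ℕ} (h : d < j) (i k : ℕ) : 𝓔.q i j k = 0 := dif_neg (by omega)

theorem q_of_gt_right {k : ℕ} (h : d < k) (i j : ℕ) : 𝓔.q i j k = 0 := dif_neg (by omega)

theorem idem_hadamard_idem (i j : ℕ) :
    𝓔.idem i ⊙ 𝓔.idem j = 𝐍⁻¹ • ∑ h ∈ Finset.range (d + 1), 𝓔.q i j h • 𝓔.idem h := by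
  by_cases hi : i < d + 1
  · by_cases hj : j < d + 1
    · rw [𝓔.idem_of_lt hi, 𝓔.idem_of_lt hj, 𝓔.hadamard_E, Finset.sum_range]
      congr 1
      refine Finset.sum_congr rfl fun h _ => ?_
      rw [𝓔.idem_val, q, dif_pos ⟨hi, hj, h.2⟩]
    · rw [𝓔.idem_of_gt (i := j) (by omega)]
      simp [𝓔.q_of_gt_mid (j := j) (by omega)]
  · rw [𝓔.idem_of_gt (i := i) (by omega)]
    simp [𝓔.q_of_gt_left (i := i) (by omega)]

theorem sum_smul_idem_mul (f : ℕ → ℝ) (h : ℕ) (hf : d < h → f h = 0) :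
    (∑ l ∈ Finset.range (d + 1), f l • 𝓔.idem l) * 𝓔.idem h = f h • 𝓔.idem h := by
  simp only [Finset.sum_mul, Matrix.smul_mul, 𝓔.idem_mul_idem, smul_ite, smul_zero]
  rw [Finset.sum_ite_eq']
  split_ifs with hh
  · rfl
  · rw [hf (by simpa using hh), zero_smul]

theorem hadamard_mul_idem (i j h : ℕ) :
    (𝓔.idem i ⊙ 𝓔.idem j) * 𝓔.idem h = (𝐍⁻¹ * 𝓔.q i j h) • 𝓔.idem h := by
  rw [idem_hadamard_idem, Matrix.smul_mul,
    𝓔.sum_smul_idem_mul _ h (fun hh => 𝓔.q_of_gt_right hh i j), smul_smul]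

theorem sum_idem_mul_idem (i : ℕ) (x y : X) :
    ∑ a, 𝓔.idem i x a * 𝓔.idem i a y = 𝓔.idem i x y := by
  have := congrFun (congrFun (𝓔.idem_mul_idem i i) x) y
  simpa [Matrix.mul_apply] using this

theorem idem_ne_zero {i : ℕ} (h : i ≤ d) : 𝓔.idem i ≠ 0 := by
  rw [𝓔.idem_of_lt (Nat.lt_succ_of_le h)]; exact 𝓔.ne_zero _

theorem mult_eq_sum_sq (i : ℕ) : 𝓔.mult i = ∑ x, ∑ y, 𝓔.idem i x y ^ 2 := by
  simp only [mult, Matrix.trace, Matrix.diag]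
  refine Finset.sum_congr rfl fun x _ => ?_
  rw [← 𝓔.sum_idem_mul_idem]
  exact Finset.sum_congr rfl fun y _ => by rw [𝓔.idem_comm i y x, sq]

theorem mult_pos {i : ℕ} (h : i ≤ d) : 0 < 𝓔.mult i := by
  rw [mult_eq_sum_sq]
  have hne := 𝓔.idem_ne_zero h
  obtain ⟨x, y, hxy⟩ : ∃ x y, 𝓔.idem i x y ≠ 0 := by
    by_contra! hc
    exact hne (by ext x y; simpa using hc x y)
  refine Finset.sum_pos' (fun _ _ => Finset.sum_nonneg fun _ _ => sq_nonneg _)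
    ⟨x, Finset.mem_univ _, Finset.sum_pos' (fun _ _ => sq_nonneg _)
      ⟨y, Finset.mem_univ _, by positivity⟩⟩

theorem card_pos (S : SymAssocScheme X d) : 0 < 𝐍 := by
  have h := card_ne_zero S
  positivity

theorem mult_zero : 𝓔.mult 0 = 1 := by
  have h := card_ne_zero S
  simp [mult, Matrix.trace, 𝓔.idem_zero_apply, h]

/-- The sum of the entries of `E_i ∘ E_j ∘ E_h`: a quantity symmetric in the three indices. -/
theorem sum_triple (i j h : ℕ) :
    ∑ x, ∑ y, 𝓔.idem i x y * 𝓔.idem j x y * 𝓔.idem h x y = 𝐍⁻¹ * 𝓔.q i j h * 𝓔.mult h := by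
  have := congrArg Matrix.trace (𝓔.hadamard_mul_idem i j h)
  rw [Matrix.trace_smul] at this
  rw [mult, ← smul_eq_mul (𝐍⁻¹ * _), ← this]
  simp only [Matrix.trace, Matrix.diag, Matrix.mul_apply, Matrix.hadamard_apply]
  exact Finset.sum_congr rfl fun x _ => Finset.sum_congr rfl fun y _ => by
    rw [𝓔.idem_comm h y x]

theorem q_mul_mult_swap (i j h : ℕ) : 𝓔.q i j h * 𝓔.mult h = 𝓔.q i h j * 𝓔.mult j := by
  have hN := card_ne_zero S
  have h1 := 𝓔.sum_triple i j h
  have h2 := 𝓔.sum_triple i h j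
  have h3 : ∑ x, ∑ y, 𝓔.idem i x y * 𝓔.idem j x y * 𝓔.idem h x y
      = ∑ x, ∑ y, 𝓔.idem i x y * 𝓔.idem h x y * 𝓔.idem j x y :=
    Finset.sum_congr rfl fun x _ => Finset.sum_congr rfl fun y _ => by ring
  rw [h1, h2, mul_assoc, mul_assoc] at h3
  exact mul_left_cancel₀ (inv_ne_zero hN) h3

theorem q_comm (i j h : ℕ) : 𝓔.q i j h = 𝓔.q j i h := by
  rcases Nat.lt_or_ge d h with hh | hh
  · rw [𝓔.q_of_gt_right hh, 𝓔.q_of_gt_right hh]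
  have hN := card_ne_zero S
  have h1 := 𝓔.sum_triple i j h
  have h2 := 𝓔.sum_triple j i h
  have h3 : ∑ x, ∑ y, 𝓔.idem i x y * 𝓔.idem j x y * 𝓔.idem h x y
      = ∑ x, ∑ y, 𝓔.idem j x y * 𝓔.idem i x y * 𝓔.idem h x y :=
    Finset.sum_congr rfl fun x _ => Finset.sum_congr rfl fun y _ => by ring
  rw [h1, h2, mul_assoc, mul_assoc] at h3
  exact mul_right_cancel₀ (𝓔.mult_pos hh).ne' (mul_left_cancel₀ (inv_ne_zero hN) h3)

theorem q_eq_zero_swap {i j h : ℕ} (hq : 𝓔.q i j h = 0) : 𝓔.q i h j = 0 := by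
  rcases Nat.lt_or_ge d j with hj | hj
  · exact 𝓔.q_of_gt_right hj i h
  have := 𝓔.q_mul_mult_swap i j h
  rw [hq, zero_mul] at this
  exact (mul_eq_zero.mp this.symm).resolve_right (𝓔.mult_pos hj).ne'

/-- A function in the range of `E_i` is reproduced by `E_i`; here for the functions
`∑_x E_i(x, ·) g(x)`. -/
theorem idem_reproduce (i : ℕ) (g : X → ℝ) (x : X) :
    ∑ a, 𝓔.idem i x a * ∑ z, 𝓔.idem i z a * g z = ∑ z, 𝓔.idem i z x * g z := by
  simp only [Finset.mul_sum]
  rw [Finset.sum_comm]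
  refine Finset.sum_congr rfl fun z _ => ?_
  rw [𝓔.idem_comm i z x, ← 𝓔.sum_idem_mul_idem i x z, Finset.sum_mul]
  exact Finset.sum_congr rfl fun a _ => by rw [𝓔.idem_comm i z a]; ring

/-- The trilinear form `∑_x E_i(x, a) E_j(x, b) E_h(x, c)`. -/
def triad (i j h : ℕ) (a b c : X) : ℝ :=
  ∑ x, 𝓔.idem i x a * (𝓔.idem j x b * 𝓔.idem h x c)

theorem sum_triad_sq (i j h : ℕ) :
    ∑ a, ∑ b, ∑ c, 𝓔.triad i j h a b c ^ 2 = 𝐍⁻¹ * 𝓔.q i j h * 𝓔.mult h := by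
  have ha (x b c : X) : ∑ a, 𝓔.idem i x a * 𝓔.triad i j h a b c = 𝓔.triad i j h x b c :=
    𝓔.idem_reproduce i _ x
  have hb (x a c : X) : ∑ b, 𝓔.idem j x b * 𝓔.triad i j h a b c = 𝓔.triad i j h a x c := by
    have := 𝓔.idem_reproduce j (fun z => 𝓔.idem i z a * 𝓔.idem h z c) x
    convert this using 4 <;> first | rfl | (simp only [triad]; exact Finset.sum_congr rfl fun _ _ => by ring)
  have hc (x a b : X) : ∑ c, 𝓔.idem h x c * 𝓔.triad i j h a b c = 𝓔.triad i j h a b x := by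
    have := 𝓔.idem_reproduce h (fun z => 𝓔.idem i z a * 𝓔.idem j z b) x
    convert this using 4 <;> first | rfl | (simp only [triad]; exact Finset.sum_congr rfl fun _ _ => by ring)
  calc ∑ a, ∑ b, ∑ c, 𝓔.triad i j h a b c ^ 2
      = ∑ a, ∑ b, ∑ c, ∑ x, 𝓔.idem i x a * (𝓔.idem j x b * (𝓔.idem h x c *
          𝓔.triad i j h a b c)) := by
        refine Finset.sum_congr rfl fun a _ => Finset.sum_congr rfl fun b _ =>
          Finset.sum_congr rfl fun c _ => ?_
        rw [sq]; nth_rw 1 [triad]; rw [Finset.sum_mul]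
        exact Finset.sum_congr rfl fun _ _ => by ring
    _ = ∑ x, ∑ a, ∑ b, ∑ c, 𝓔.idem i x a * (𝓔.idem j x b * (𝓔.idem h x c *
          𝓔.triad i j h a b c)) := by
        rw [Finset.sum_comm (s := (Finset.univ : Finset X)) (t := (Finset.univ : Finset X))
          (f := fun x a => ∑ b, ∑ c, 𝓔.idem i x a * (𝓔.idem j x b * (𝓔.idem h x c *
          𝓔.triad i j h a b c)))]
        refine Finset.sum_congr rfl fun a _ => ?_
        rw [Finset.sum_comm (s := (Finset.univ : Finset X)) (t := (Finset.univ : Finset X))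
          (f := fun x b => ∑ c, 𝓔.idem i x a * (𝓔.idem j x b * (𝓔.idem h x c *
          𝓔.triad i j h a b c)))]
        refine Finset.sum_congr rfl fun b _ => ?_
        rw [Finset.sum_comm]
    _ = ∑ x, 𝓔.triad i j h x x x := by
        refine Finset.sum_congr rfl fun x _ => ?_
        simp only [← Finset.mul_sum, hc, hb, ha]
    _ = _ := by
        rw [← sum_triple, Finset.sum_comm]
        simp only [triad]
        exact Finset.sum_congr rfl fun _ _ => Finset.sum_congr rfl fun _ _ => by ring

theorem q_nonneg (i j h : ℕ) : 0 ≤ 𝓔.q i j h := by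
  rcases Nat.lt_or_ge d h with hh | hh
  · rw [𝓔.q_of_gt_right hh]
  have h1 : 0 ≤ 𝐍⁻¹ * 𝓔.q i j h * 𝓔.mult h := by
    rw [← sum_triad_sq]
    exact Finset.sum_nonneg fun _ _ => Finset.sum_nonneg fun _ _ =>
      Finset.sum_nonneg fun _ _ => sq_nonneg _
  have h2 := nonneg_of_mul_nonneg_left h1 (𝓔.mult_pos hh)
  exact nonneg_of_mul_nonneg_right h2 (inv_pos.mpr (card_pos S))

/-- The criterion of Cameron, Goethals and Seidel: a vanishing Krein parameter forces the whole
trilinear form to vanish, the Krein parameter being a sum of squares of its values. -/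
theorem triad_eq_zero {i j h : ℕ} (hq : 𝓔.q i j h = 0) (a b c : X) :
    𝓔.triad i j h a b c = 0 := by
  have h0 := 𝓔.sum_triad_sq i j h
  rw [hq, mul_zero, zero_mul] at h0
  rw [Finset.sum_eq_zero_iff_of_nonneg (fun _ _ => Finset.sum_nonneg fun _ _ =>
      Finset.sum_nonneg fun _ _ => sq_nonneg _)] at h0
  have h1 := h0 a (Finset.mem_univ _)
  rw [Finset.sum_eq_zero_iff_of_nonneg (fun _ _ => Finset.sum_nonneg fun _ _ => sq_nonneg _)] at h1
  have h2 := h1 b (Finset.mem_univ _)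
  rw [Finset.sum_eq_zero_iff_of_nonneg (fun _ _ => sq_nonneg _)] at h2
  exact pow_eq_zero_iff (two_ne_zero) |>.mp (h2 c (Finset.mem_univ _))

/-- The diagonal of a matrix of the Bose–Mesner algebra is constant, as `R_0` is the identity
relation. -/
theorem idem_diag (i : ℕ) (x : X) : 𝐍 * 𝓔.idem i x x = 𝓔.mult i := by
  have hdiag : ∀ M ∈ S.boseMesner, ∀ y z : X, M y y = M z z := by
    intro M hM y z
    have h1 (w : X) : S.R 0 w w := by
      have := congrFun (congrFun S.as1 w) w
      by_contra hc
      simp [relMatrix, hc] at this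
    induction hM using Submodule.span_induction with
    | zero => simp
    | add a b _ _ ha hb => simp [ha, hb]
    | smul c a _ ha => simp [ha]
    | mem a ha =>
      obtain ⟨k, rfl⟩ := ha
      rw [S.A_apply_of_rel (h1 y), S.A_apply_of_rel (h1 z)]
  simp only [mult, Matrix.trace, Matrix.diag]
  rw [Finset.sum_congr rfl fun y _ => hdiag _ (𝓔.idem_mem i) y x]
  simp

theorem sum_q_mid (i : ℕ) {j : ℕ} (hj : j ≤ d) :
    ∑ l ∈ Finset.range (d + 1), 𝓔.q i l j = 𝓔.mult i := by
  have hN := card_ne_zero S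
  have h1 : ∑ l ∈ Finset.range (d + 1), (𝓔.idem i ⊙ 𝓔.idem l) * 𝓔.idem j
      = (𝐍⁻¹ * 𝓔.mult i) • 𝓔.idem j := by
    rw [← Finset.sum_mul]
    have : ∑ l ∈ Finset.range (d + 1), (𝓔.idem i ⊙ 𝓔.idem l) = (𝐍⁻¹ * 𝓔.mult i) • 1 := by
      ext x y
      have h2 := congrFun (congrFun 𝓔.sum_idem x) y
      rw [Matrix.sum_apply] at h2
      simp only [Matrix.sum_apply, Matrix.hadamard_apply, ← Finset.mul_sum, h2]
      by_cases hxy : x = y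
      · subst hxy
        simp [← 𝓔.idem_diag i x, hN]
      · simp [Matrix.one_apply_ne hxy]
    rw [this, Matrix.smul_mul, Matrix.one_mul]
  simp only [hadamard_mul_idem, ← Finset.sum_smul, ← Finset.mul_sum] at h1
  have h2 := smul_left_injective ℝ (𝓔.idem_ne_zero hj) h1
  exact mul_left_cancel₀ (inv_ne_zero hN) h2

theorem q_zero_left {i : ℕ} (hi : i ≤ d) (j : ℕ) : 𝓔.q 0 i j = if i = j then 1 else 0 := by
  have hN := card_ne_zero S
  rcases Nat.lt_or_ge d j with hj | hj
  · rw [𝓔.q_of_gt_right hj, if_neg (by omega)]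
  have h0 : 𝓔.idem 0 ⊙ 𝓔.idem i = 𝐍⁻¹ • 𝓔.idem i := by
    ext x y; simp [𝓔.idem_zero_apply]
  have h1 := 𝓔.hadamard_mul_idem 0 i j
  rw [h0, Matrix.smul_mul, idem_mul_idem] at h1
  split_ifs at h1 ⊢ with h
  · subst h
    have h2 := smul_left_injective ℝ (𝓔.idem_ne_zero hj) h1
    exact (mul_left_cancel₀ (inv_ne_zero hN) (h2.symm.trans (mul_one _).symm))
  · rw [smul_zero] at h1
    have := (smul_eq_zero.mp h1.symm).resolve_right (𝓔.idem_ne_zero hj)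
    exact (mul_eq_zero.mp this).resolve_left (inv_ne_zero hN)

theorem q_self_zero {i : ℕ} (hi : i ≤ d) : 𝓔.q i i 0 = 𝓔.mult i := by
  have := 𝓔.q_mul_mult_swap i i 0
  rwa [mult_zero, mul_one, 𝓔.q_comm i 0 i, 𝓔.q_zero_left hi, if_pos rfl, one_mul] at this

/-- Associativity of the entrywise product, in terms of Krein parameters. -/
theorem sum_q_mul_q (i j k h : ℕ) :
    ∑ l ∈ Finset.range (d + 1), 𝓔.q i j l * 𝓔.q l k h
      = ∑ l ∈ Finset.range (d + 1), 𝓔.q i k l * 𝓔.q l j h := by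
  have hN := card_ne_zero S
  rcases Nat.lt_or_ge d h with hh | hh
  · simp [𝓔.q_of_gt_right hh]
  have key (j k : ℕ) : ((𝓔.idem i ⊙ 𝓔.idem j) ⊙ 𝓔.idem k) * 𝓔.idem h
      = (𝐍⁻¹ * (𝐍⁻¹ * ∑ l ∈ Finset.range (d + 1), 𝓔.q i j l * 𝓔.q l k h)) • 𝓔.idem h := by
    have hs : (𝓔.idem i ⊙ 𝓔.idem j) ⊙ 𝓔.idem k
        = 𝐍⁻¹ • ∑ l ∈ Finset.range (d + 1), 𝓔.q i j l • (𝓔.idem l ⊙ 𝓔.idem k) := by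
      rw [𝓔.idem_hadamard_idem i j]
      ext x y
      simp [Matrix.sum_apply, Finset.sum_mul, mul_assoc]
    rw [hs, Matrix.smul_mul, Finset.sum_mul]
    simp only [Matrix.smul_mul, hadamard_mul_idem, smul_smul, ← Finset.sum_smul]
    congr 2
    rw [Finset.mul_sum]
    exact Finset.sum_congr rfl fun _ _ => by ring
  have h1 : (𝓔.idem i ⊙ 𝓔.idem j) ⊙ 𝓔.idem k = (𝓔.idem i ⊙ 𝓔.idem k) ⊙ 𝓔.idem j := by
    ext x y; simp only [Matrix.hadamard_apply]; ring
  have h2 := key j k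
  rw [h1, key k j] at h2
  have h3 := smul_left_injective ℝ (𝓔.idem_ne_zero hh) h2
  exact (mul_left_cancel₀ (inv_ne_zero hN) (mul_left_cancel₀ (inv_ne_zero hN) h3)).symm

end IdempotentOrdering

/-! ### Krein parameters of cometric schemes -/

namespace IdempotentOrdering
variable {S : SymAssocScheme X d} (𝓔 : S.IdempotentOrdering)

theorem card_mul_idem_apply {k : Fin (d + 1)} {x y : X} (h : S.R k x y) (i : Fin (d + 1)) :
    𝐍 * 𝓔.idem i x y = 𝓔.Q k i := by
  have hN := card_ne_zero S
  rw [𝓔.idem_val, 𝓔.E_eq_sum_A]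
  simp [Matrix.sum_apply, S.A_apply_of_rel h, hN]

theorem card_mul_idem_one_apply (hd : 1 ≤ d) {k : Fin (d + 1)} {x y : X} (h : S.R k x y) :
    𝐍 * 𝓔.idem 1 x y = 𝓔.Q k 1 := by
  have h1 := 𝓔.card_mul_idem_apply h 1
  have h2 : ((1 : Fin (d + 1)) : ℕ) = 1 := by
    rw [Fin.val_one']; exact Nat.mod_eq_of_lt (by omega)
  rwa [h2] at h1

theorem firstMultiplicity_eq (hd : 1 ≤ d) : 𝓔.firstMultiplicity = 𝓔.mult 1 := by
  obtain ⟨x, y, hxy⟩ := S.nonempty 0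
  have h1 := congrFun (congrFun S.as1 x) y
  have hxy' : x = y := by
    by_contra hc
    simp [relMatrix, hxy, Matrix.one_apply_ne hc] at h1
  subst hxy'
  have h2 := 𝓔.card_mul_idem_one_apply hd hxy
  rw [𝓔.idem_diag] at h2
  exact h2.symm

theorem mem_boseMesner_eq_sum {M : Matrix X X ℝ} (hM : M ∈ S.boseMesner) :
    ∃ f : Fin (d + 1) → ℝ, M = ∑ i, f i • 𝓔.E i := by
  refine ⟨fun i => 𝓔.basisE.repr ⟨M, hM⟩ i, ?_⟩
  have h := congrArg Subtype.val (𝓔.basisE.sum_repr ⟨M, hM⟩)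
  have hb : ∀ j, ((𝓔.basisE j : S.boseMesner) : Matrix X X ℝ) = 𝓔.E j := fun j => by
    simp [basisE]
  simp only [Submodule.coe_sum, Submodule.coe_smul, hb] at h
  exact h.symm

theorem Q_one_injective (hcom : 𝓔.IsCometric) : Function.Injective fun k => 𝓔.Q k 1 := by
  intro k l hkl
  by_contra hne
  obtain ⟨x, y, hxy⟩ := S.nonempty k
  obtain ⟨x', y', hxy'⟩ := S.nonempty l
  have hN := card_ne_zero S
  have hE (i : Fin (d + 1)) : 𝓔.E i x y = 𝓔.E i x' y' := by
    obtain ⟨v, -, hv⟩ := hcom i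
    have h1 := 𝓔.card_mul_idem_apply hxy i
    have h2 := 𝓔.card_mul_idem_apply hxy' i
    rw [𝓔.idem_val] at h1 h2
    have h3 : 𝓔.Q k i = 𝓔.Q l i := by
      rw [hv, hv]; exact congrArg (fun t => v.eval t) hkl
    exact mul_left_cancel₀ hN (h1.trans (h3.trans h2.symm))
  obtain ⟨f, hf⟩ := 𝓔.mem_boseMesner_eq_sum (Submodule.subset_span ⟨k, rfl⟩ : S.A k ∈ S.boseMesner)
  have h1 : S.A k x y = S.A k x' y' := by
    rw [hf]; simp [Matrix.sum_apply, hE]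
  rw [S.A_apply_of_rel hxy, S.A_apply_of_rel hxy', if_pos rfl, if_neg hne] at h1
  exact one_ne_zero h1

theorem exists_polynomials (hcom : 𝓔.IsCometric) (hd : 1 ≤ d) :
    ∃ v : ℕ → Polynomial ℝ, (∀ i ≤ d, (v i).degree = (i : WithBot ℕ)) ∧
      ∀ i ≤ d, ∀ x y, 𝐍 * 𝓔.idem i x y = (v i).eval (𝐍 * 𝓔.idem 1 x y) := by
  choose v hv hQ using hcom
  refine ⟨fun i => if h : i < d + 1 then v ⟨i, h⟩ else 0, fun i hi => ?_, fun i hi x y => ?_⟩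
  · simp only [dif_pos (Nat.lt_succ_of_le hi), hv]
  · simp only [dif_pos (Nat.lt_succ_of_le hi)]
    obtain ⟨k, hk⟩ := S.exists_rel x y
    have h1 := 𝓔.card_mul_idem_apply hk ⟨i, Nat.lt_succ_of_le hi⟩
    have h2 := 𝓔.card_mul_idem_one_apply hd hk
    rw [h2, ← hQ, ← h1]

/-- The `d + 1` dual eigenvalues are distinct, so a polynomial of degree at most `d` is determined
by its values at them. -/
theorem polynomial_eq_zero (hcom : 𝓔.IsCometric) (hd : 1 ≤ d) {p : Polynomial ℝ}
    (hp : p.degree ≤ (d : WithBot ℕ)) (h0 : ∀ x y, p.eval (𝐍 * 𝓔.idem 1 x y) = 0) : p = 0 := by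
  refine Polynomial.eq_zero_of_degree_lt_of_eval_index_eq_zero (s := Finset.univ)
    (v := fun k => 𝓔.Q k 1) (𝓔.Q_one_injective hcom).injOn ?_ ?_
  · refine lt_of_le_of_lt hp ?_
    rw [Finset.card_univ, Fintype.card_fin]
    exact_mod_cast Nat.lt_succ_self d
  · intro k _
    obtain ⟨x, y, hxy⟩ := S.nonempty k
    rw [← 𝓔.card_mul_idem_one_apply hd hxy]; exact h0 x y

/-- In a combination of polynomials `v_0, …, v_d` with `deg v_h = h`, the degree is the largest
index with nonzero coefficient. -/
theorem _root_.Polynomial.coeff_eq_of_sum_eq {v : ℕ → Polynomial ℝ}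
    (hv : ∀ i ≤ d, (v i).degree = (i : WithBot ℕ)) {p : Polynomial ℝ} {n : ℕ}
    (hp : p.degree = (n : WithBot ℕ)) {c : ℕ → ℝ}
    (hs : p = ∑ h ∈ Finset.range (d + 1), c h • v h) :
    (n ≤ d ∧ c n ≠ 0) ∧ ∀ h ≤ d, n < h → c h = 0 := by
  classical
  set s := (Finset.range (d + 1)).filter fun h => c h ≠ 0 with hsdef
  have hne : s.Nonempty := by
    rw [Finset.nonempty_iff_ne_empty]
    intro hemp
    have : p = 0 := by
      rw [hs]
      refine Finset.sum_eq_zero fun h hh => ?_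
      have : h ∉ s := by simp [hemp]
      have hc : c h = 0 := by
        by_contra hc
        exact this (Finset.mem_filter.mpr ⟨hh, hc⟩)
      rw [hc, zero_smul]
    rw [this] at hp
    simp at hp
  set H := s.max' hne
  have hH : H ∈ s := s.max'_mem hne
  have hH' := Finset.mem_filter.mp hH
  have hHd : H ≤ d := Nat.lt_succ_iff.mp (Finset.mem_range.mp hH'.1)
  have hmax (h : ℕ) (hh : h ≤ d) (hlt : H < h) : c h = 0 := by
    by_contra hc
    have := s.le_max' h (Finset.mem_filter.mpr ⟨Finset.mem_range.mpr (by omega), hc⟩)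
    omega
  have hcoeff (k : ℕ) (hk : H ≤ k) : p.coeff k = c H * (v H).coeff k := by
    rw [hs, Polynomial.finsetSum_coeff, Finset.sum_eq_single H]
    · simp
    · intro h hh hne'
      have hhd : h ≤ d := Nat.lt_succ_iff.mp (Finset.mem_range.mp hh)
      rcases lt_or_gt_of_ne hne' with hlt | hlt
      · rw [Polynomial.coeff_smul, Polynomial.coeff_eq_zero_of_degree_lt, smul_zero]
        rw [hv h hhd]; exact_mod_cast lt_of_lt_of_le hlt hk
      · rw [hmax h hhd hlt, zero_smul, Polynomial.coeff_zero]
    · intro hc; exact absurd hH'.1 hc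
  have hdeg : p.degree = (H : WithBot ℕ) := by
    refine Polynomial.degree_eq_of_le_of_coeff_ne_zero ?_ ?_
    · rw [Polynomial.degree_le_iff_coeff_zero]
      intro k hk
      have hk' : H < k := by exact_mod_cast hk
      rw [hcoeff k hk'.le, Polynomial.coeff_eq_zero_of_degree_lt, mul_zero]
      rw [hv H hHd]; exact hk
    · rw [hcoeff H le_rfl]
      exact mul_ne_zero hH'.2 (Polynomial.coeff_ne_zero_of_eq_degree (hv H hHd))
  have hnH : n = H := by
    rw [hp] at hdeg; exact_mod_cast hdeg
  subst hnH
  exact ⟨⟨hHd, hH'.2⟩, hmax⟩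

theorem q_top (hcom : 𝓔.IsCometric) (hd : 1 ≤ d) {i j : ℕ} (hij : i + j ≤ d) :
    𝓔.q i j (i + j) ≠ 0 ∧ ∀ h, i + j < h → 𝓔.q i j h = 0 := by
  obtain ⟨v, hv, hvE⟩ := 𝓔.exists_polynomials hcom hd
  have hN := card_ne_zero S
  have hdeg : (v i * v j).degree = ((i + j : ℕ) : WithBot ℕ) := by
    rw [Polynomial.degree_mul, hv i (by omega), hv j (by omega)]; push_cast; rfl
  have hs : v i * v j = ∑ h ∈ Finset.range (d + 1), 𝓔.q i j h • v h := by
    rw [← sub_eq_zero]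
    refine 𝓔.polynomial_eq_zero hcom hd ?_ fun x y => ?_
    · refine (Polynomial.degree_sub_le _ _).trans (max_le ?_ ?_)
      · rw [hdeg]; exact_mod_cast hij
      · refine (Polynomial.degree_sum_le _ _).trans (Finset.sup_le fun h hh => ?_)
        have hhd : h ≤ d := Nat.lt_succ_iff.mp (Finset.mem_range.mp hh)
        refine (Polynomial.degree_smul_le _ _).trans ?_
        rw [hv h hhd]; exact_mod_cast hhd
    · rw [Polynomial.eval_sub, Polynomial.eval_mul, ← hvE i (by omega), ← hvE j (by omega),
        Polynomial.eval_finsetSum, sub_eq_zero]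
      have h1 := congrFun (congrFun (𝓔.idem_hadamard_idem i j) x) y
      simp only [Matrix.hadamard_apply, Matrix.smul_apply, Matrix.sum_apply, smul_eq_mul] at h1
      calc 𝐍 * 𝓔.idem i x y * (𝐍 * 𝓔.idem j x y)
          = 𝐍 ^ 2 * (𝓔.idem i x y * 𝓔.idem j x y) := by ring
        _ = ∑ h ∈ Finset.range (d + 1), 𝓔.q i j h * (𝐍 * 𝓔.idem h x y) := by
          rw [h1, ← mul_assoc, sq, mul_assoc 𝐍, mul_inv_cancel₀ hN, mul_one, Finset.mul_sum]
          exact Finset.sum_congr rfl fun _ _ => by ring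
        _ = _ := by
          refine Finset.sum_congr rfl fun h hh => ?_
          rw [Polynomial.eval_smul, smul_eq_mul,
            hvE h (Nat.lt_succ_iff.mp (Finset.mem_range.mp hh))]
  obtain ⟨⟨-, h1⟩, h2⟩ := Polynomial.coeff_eq_of_sum_eq hv hdeg hs
  refine ⟨h1, fun h hh => ?_⟩
  rcases Nat.lt_or_ge d h with hd' | hd'
  · exact 𝓔.q_of_gt_right hd' i j
  · exact h2 h hd' hh

variable {𝓔}

theorem IsCometric.q_add_pos (hcom : 𝓔.IsCometric) (hd : 1 ≤ d) {i j : ℕ} (hij : i + j ≤ d) :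
    0 < 𝓔.q i j (i + j) :=
  lt_of_le_of_ne (𝓔.q_nonneg _ _ _) (𝓔.q_top hcom hd hij).1.symm

theorem IsCometric.q_sub_pos (hcom : 𝓔.IsCometric) (hd : 1 ≤ d) {i j : ℕ} (hij : i + j ≤ d) :
    0 < 𝓔.q i (i + j) j :=
  lt_of_le_of_ne (𝓔.q_nonneg _ _ _)
    fun h => (hcom.q_add_pos hd hij).ne' (𝓔.q_eq_zero_swap h.symm)

theorem IsCometric.q_eq_zero (hcom : 𝓔.IsCometric) (hd : 1 ≤ d) {i j h : ℕ} (hij : i + j < h) :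
    𝓔.q i j h = 0 := by
  rcases Nat.lt_or_ge d (i + j) with h' | h'
  · exact 𝓔.q_of_gt_right (by omega) i j
  · exact (𝓔.q_top hcom hd h').2 h hij

theorem IsCometric.q_one_eq_zero (hcom : 𝓔.IsCometric) (hd : 1 ≤ d) {j h : ℕ}
    (hjh : j + 1 < h ∨ h + 1 < j) : 𝓔.q 1 j h = 0 := by
  rcases hjh with hjh | hjh
  · exact hcom.q_eq_zero hd (by omega)
  · exact 𝓔.q_eq_zero_swap (hcom.q_eq_zero hd (by omega))

theorem sum_range_eq_three {f : ℕ → ℝ} (j : ℕ) (hz : ∀ l, l ≠ j → l ≠ j + 1 → l ≠ j + 2 → f l = 0)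
    (hgt : ∀ l, d < l → f l = 0) :
    ∑ l ∈ Finset.range (d + 1), f l = f j + f (j + 1) + f (j + 2) := by
  have h1 : ∑ l ∈ Finset.range (d + 1), f l = ∑ l ∈ Finset.range (d + j + 3), f l := by
    refine Finset.sum_subset (Finset.range_mono (by omega)) fun l _ hl => hgt l ?_
    simpa [Nat.lt_succ_iff] using hl
  have h2 : ∑ l ∈ ({j, j + 1, j + 2} : Finset ℕ), f l = ∑ l ∈ Finset.range (d + j + 3), f l := by
    refine Finset.sum_subset ?_ fun l _ hl => ?_
    · intro l hl
      simp only [Finset.mem_insert, Finset.mem_singleton] at hl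
      exact Finset.mem_range.mpr (by omega)
    · simp only [Finset.mem_insert, Finset.mem_singleton, not_or] at hl
      exact hz l hl.1 hl.2.1 hl.2.2
  rw [h1, ← h2, Finset.sum_insert (by simp), Finset.sum_insert (by simp), Finset.sum_singleton]
  ring

theorem IsCometric.q_one_sum (hcom : 𝓔.IsCometric) (hd : 1 ≤ d) {j : ℕ} (hj : j + 1 ≤ d) :
    𝓔.q 1 j (j + 1) + 𝓔.q 1 (j + 1) (j + 1) + 𝓔.q 1 (j + 2) (j + 1) = 𝓔.mult 1 := by
  rw [← 𝓔.sum_q_mid 1 hj]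
  refine (sum_range_eq_three j (fun l h1 h2 h3 => hcom.q_one_eq_zero hd (by omega))
    fun l hl => 𝓔.q_of_gt_mid hl _ _).symm

end IdempotentOrdering

/-! ### Tetrahedral sums -/

namespace IdempotentOrdering
variable {S : SymAssocScheme X d} (𝓔 : S.IdempotentOrdering)

/-- The tetrahedral sum: the four vertices range over `X`, the six edges carry entries of
idempotents, and `(p, p')`, `(q, q')`, `(r, r')` are the pairs of opposite edges. -/
def tetra (p p' q q' r r' : ℕ) : ℝ :=
  ∑ x, ∑ y, ∑ z, ∑ w, 𝓔.idem p x y * 𝓔.idem p' z w * 𝓔.idem q x z * 𝓔.idem q' y w *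
    𝓔.idem r x w * 𝓔.idem r' y z

theorem tetra_swap_fst_snd (p p' q q' r r' : ℕ) :
    𝓔.tetra p p' q q' r r' = 𝓔.tetra q q' p p' r r' := by
  unfold tetra
  refine Finset.sum_congr rfl fun x _ => ?_
  rw [Finset.sum_comm]
  refine Finset.sum_congr rfl fun y _ => Finset.sum_congr rfl fun z _ =>
    Finset.sum_congr rfl fun w _ => ?_
  rw [𝓔.idem_comm r' z y]; ring

theorem tetra_swap_snd_thd (p p' q q' r r' : ℕ) :
    𝓔.tetra p p' q q' r r' = 𝓔.tetra p p' r r' q q' := by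
  unfold tetra
  refine Finset.sum_congr rfl fun x _ => Finset.sum_congr rfl fun y _ => ?_
  rw [Finset.sum_comm]
  refine Finset.sum_congr rfl fun z _ => Finset.sum_congr rfl fun w _ => ?_
  rw [𝓔.idem_comm p' w z]; ring

theorem tetra_flip_snd_thd (p p' q q' r r' : ℕ) :
    𝓔.tetra p p' q q' r r' = 𝓔.tetra p p' q' q r' r := by
  unfold tetra
  rw [Finset.sum_comm]
  refine Finset.sum_congr rfl fun x _ => Finset.sum_congr rfl fun y _ => ?_
  rw [Finset.sum_comm]
  refine Finset.sum_congr rfl fun z _ => Finset.sum_congr rfl fun w _ => ?_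
  rw [𝓔.idem_comm p' w z, 𝓔.idem_comm p y x]; ring

/-- A tetrahedral sum vanishes when the Krein parameter of the three edges at a vertex does. -/
theorem tetra_eq_zero {p q r : ℕ} (h : 𝓔.q p q r = 0) (p' q' r' : ℕ) :
    𝓔.tetra p p' q q' r r' = 0 := by
  unfold tetra
  have h1 : ∀ y z w, ∑ x, 𝓔.idem p x y * 𝓔.idem p' z w * 𝓔.idem q x z * 𝓔.idem q' y w *
    𝓔.idem r x w * 𝓔.idem r' y z = 0 := fun y z w => by
    have h2 := 𝓔.triad_eq_zero h y z w
    have h3 : ∑ x, 𝓔.idem p x y * 𝓔.idem p' z w * 𝓔.idem q x z * 𝓔.idem q' y w *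
        𝓔.idem r x w * 𝓔.idem r' y z
        = (𝓔.idem p' z w * 𝓔.idem q' y w * 𝓔.idem r' y z) * 𝓔.triad p q r y z w := by
      rw [triad, Finset.mul_sum]
      exact Finset.sum_congr rfl fun _ _ => by ring
    rw [h3, h2, mul_zero]
  rw [Finset.sum_comm]
  refine Finset.sum_eq_zero fun y _ => ?_
  rw [Finset.sum_comm]
  refine Finset.sum_eq_zero fun z _ => ?_
  rw [Finset.sum_comm]
  exact Finset.sum_eq_zero fun w _ => h1 y z w

theorem tetra_eq_zero' {p q' r' : ℕ} (h : 𝓔.q p q' r' = 0) (p' q r : ℕ) :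
    𝓔.tetra p p' q q' r r' = 0 := by
  rw [tetra_flip_snd_thd]; exact 𝓔.tetra_eq_zero h _ _ _

/-- Summing over the label of an edge contracts it, as the idempotents sum to the identity. -/
theorem sum_tetra (p' q q' r r' : ℕ) :
    ∑ l ∈ Finset.range (d + 1), 𝓔.tetra l p' q q' r r'
      = 𝐍⁻¹ ^ 2 * (𝓔.q q r' p' * 𝓔.q q' r p' * 𝓔.mult p') := by
  have hI (x y : X) : ∑ l ∈ Finset.range (d + 1), 𝓔.idem l x y = if x = y then 1 else 0 := by
    have := congrFun (congrFun 𝓔.sum_idem x) y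
    rwa [Matrix.sum_apply, Matrix.one_apply] at this
  have h1 : ∑ l ∈ Finset.range (d + 1), 𝓔.tetra l p' q q' r r'
      = ∑ x, ∑ y, (if x = y then 1 else 0) * ∑ z, ∑ w, 𝓔.idem p' z w * 𝓔.idem q x z *
        𝓔.idem q' y w * 𝓔.idem r x w * 𝓔.idem r' y z := by
    simp only [tetra]
    rw [Finset.sum_comm]
    refine Finset.sum_congr rfl fun x _ => ?_
    rw [Finset.sum_comm]
    refine Finset.sum_congr rfl fun y _ => ?_
    rw [← hI x y, Finset.sum_mul]
    refine Finset.sum_congr rfl fun l _ => ?_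
    simp only [Finset.mul_sum]
    exact Finset.sum_congr rfl fun _ _ => Finset.sum_congr rfl fun _ _ => by ring
  have h2 (x w : X) : ∑ z, 𝓔.idem q x z * 𝓔.idem r' x z * 𝓔.idem p' z w
      = 𝐍⁻¹ * 𝓔.q q r' p' * 𝓔.idem p' x w := by
    have := congrFun (congrFun (𝓔.hadamard_mul_idem q r' p') x) w
    simpa [Matrix.mul_apply] using this
  rw [h1]
  simp only [ite_mul, one_mul, zero_mul, Finset.sum_ite_eq, Finset.mem_univ, if_true]
  calc ∑ x, ∑ z, ∑ w, 𝓔.idem p' z w * 𝓔.idem q x z * 𝓔.idem q' x w * 𝓔.idem r x w *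
        𝓔.idem r' x z
      = ∑ x, ∑ w, (𝓔.idem q' x w * 𝓔.idem r x w) *
          ∑ z, 𝓔.idem q x z * 𝓔.idem r' x z * 𝓔.idem p' z w := by
        refine Finset.sum_congr rfl fun x _ => ?_
        rw [Finset.sum_comm]
        refine Finset.sum_congr rfl fun w _ => ?_
        rw [Finset.mul_sum]
        exact Finset.sum_congr rfl fun _ _ => by ring
    _ = (𝐍⁻¹ * 𝓔.q q r' p') *
          ∑ x, ∑ w, 𝓔.idem q' x w * 𝓔.idem r x w * 𝓔.idem p' x w := by
        simp only [h2, Finset.mul_sum]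
        exact Finset.sum_congr rfl fun _ _ => Finset.sum_congr rfl fun _ _ => by ring
    _ = _ := by rw [sum_triple]; ring

theorem tetra_zero (p' i j : ℕ) :
    𝓔.tetra 0 p' i j i j = 𝐍⁻¹ ^ 2 * (𝓔.q i j p' * 𝓔.mult p') := by
  have hsq (i : ℕ) (z w : X) : ∑ x, 𝓔.idem i x z * 𝓔.idem i x w = 𝓔.idem i z w := by
    rw [← 𝓔.sum_idem_mul_idem]
    exact Finset.sum_congr rfl fun x _ => by rw [𝓔.idem_comm i x z]
  calc 𝓔.tetra 0 p' i j i j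
      = ∑ z, ∑ w, ∑ x, ∑ y, 𝐍⁻¹ * (𝓔.idem p' z w * ((𝓔.idem i x z * 𝓔.idem i x w) *
          (𝓔.idem j y z * 𝓔.idem j y w))) := by
        unfold tetra
        simp only [idem_zero_apply]
        calc _ = ∑ x, ∑ z, ∑ w, ∑ y, 𝐍⁻¹ * (𝓔.idem p' z w * ((𝓔.idem i x z * 𝓔.idem i x w) *
          (𝓔.idem j y z * 𝓔.idem j y w))) := by
              refine Finset.sum_congr rfl fun x _ => ?_
              rw [Finset.sum_comm]
              refine Finset.sum_congr rfl fun z _ => ?_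
              rw [Finset.sum_comm]
              exact Finset.sum_congr rfl fun w _ => Finset.sum_congr rfl fun y _ => by ring
          _ = _ := by
              rw [Finset.sum_comm]
              refine Finset.sum_congr rfl fun z _ => ?_
              rw [Finset.sum_comm]
    _ = 𝐍⁻¹ * ∑ z, ∑ w, 𝓔.idem i z w * 𝓔.idem j z w * 𝓔.idem p' z w := by
        simp only [← Finset.mul_sum, ← Finset.sum_mul, hsq]
        congr 1
        exact Finset.sum_congr rfl fun _ _ => Finset.sum_congr rfl fun _ _ => by ring
    _ = _ := by rw [sum_triple]; ring

variable {𝓔}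

/-- If `a_t^* = 0 = q_{2,t}^t`, then `q_{1,t}^h` is `0` or `1`: of the tetrahedral sums with opposite
pairs `(l, h)`, `(1, t)`, `(1, t)` only the one with `l = 0` survives. -/
theorem IsCometric.q_one_eq_one (hcom : 𝓔.IsCometric) (hd : 1 ≤ d) {t h : ℕ}
    (ha : 𝓔.q 1 t t = 0) (h2 : 𝓔.q 2 t t = 0) (hh : h ≤ d) (hq : 𝓔.q 1 t h ≠ 0) :
    𝓔.q 1 t h = 1 := by
  have h1 := 𝓔.sum_tetra h 1 t 1 t
  rw [Finset.sum_eq_single 0, tetra_zero, 𝓔.q_comm t 1 h] at h1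
  · have hN := card_ne_zero S
    have hm := (𝓔.mult_pos hh).ne'
    have h3 := mul_left_cancel₀ (pow_ne_zero 2 (inv_ne_zero hN)) h1
    have h4 := mul_right_cancel₀ hm h3
    exact (mul_left_cancel₀ hq (h4.symm.trans (mul_one _).symm))
  · intro l _ hl
    by_cases hl1 : l = 1
    · subst hl1
      exact 𝓔.tetra_eq_zero' ha _ _ _
    by_cases hl2 : l = 2
    · subst hl2
      exact 𝓔.tetra_eq_zero' h2 _ _ _
    · refine 𝓔.tetra_eq_zero ?_ _ _ _
      exact 𝓔.q_eq_zero_swap (by rw [𝓔.q_comm]; exact 𝓔.q_eq_zero_swap (hcom.q_eq_zero hd (by omega)))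
  · intro hc; simp at hc

/-- The mixed tetrahedral sum at an index `t` with `a_t^* = 0`, in terms of `b_t^*` and
`c_{t+1}^*` only. -/
theorem IsCometric.tetra_mixed (hcom : 𝓔.IsCometric) (hd : 1 ≤ d) {t : ℕ} (ht : t + 1 ≤ d)
    (ha : 𝓔.q 1 t t = 0) :
    𝓔.tetra (t + 1) (t + 1) t t 1 1 = 𝐍⁻¹ ^ 2 * ((𝓔.q 1 (t + 1) t * 𝓔.mult t) *
      (𝓔.q 1 (t + 1) t + 𝓔.q 1 t (t + 1) - 𝓔.mult 1)) := by
  have hz (j h : ℕ) (hjh : j + 1 < h ∨ h + 1 < j) : 𝓔.q j 1 h = 0 := by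
    rw [𝓔.q_comm]; exact hcom.q_one_eq_zero hd hjh
  have hid {l : ℕ} (hl : d < l) (p' q q' r r' : ℕ) : 𝓔.tetra l p' q q' r r' = 0 :=
    𝓔.tetra_eq_zero (𝓔.q_of_gt_left hl _ _) _ _ _
  -- in `e1` the labels `t`, `t + 1`, `t + 2` survive; the two larger ones are then evaluated in `e2`
  -- and `e3` by summing over the opposite pair, where `a_t^* = 0` leaves the label `t + 1` only
  have e1 := 𝓔.sum_tetra t 1 1 (t + 1) (t + 1)
  rw [sum_range_eq_three t (fun l h1 h2 h3 => 𝓔.tetra_eq_zero (hz _ _ (by omega)) _ _ _)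
    (fun l hl => hid hl _ _ _ _ _)] at e1
  have e2 := 𝓔.sum_tetra (t + 1) 1 1 (t + 1) t
  rw [Finset.sum_eq_single (t + 1)] at e2
  rotate_left
  · intro l _ hl
    by_cases hlt : l = t
    · subst hlt
      exact 𝓔.tetra_eq_zero' (by rw [𝓔.q_comm]; exact ha) _ _ _
    by_cases hlt2 : l = t + 2
    · subst hlt2
      exact 𝓔.tetra_eq_zero' (hz _ _ (by omega)) _ _ _
    · exact 𝓔.tetra_eq_zero (hz _ _ (by omega)) _ _ _
  · intro hc; exact absurd (Finset.mem_range.mpr (by omega)) hc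
  have e3 := 𝓔.sum_tetra (t + 1) 1 1 (t + 2) t
  rw [Finset.sum_eq_single (t + 1)] at e3
  rotate_left
  · intro l _ hl
    by_cases hlt : l < t + 2
    · refine 𝓔.tetra_eq_zero (hz _ _ ?_) _ _ _
      omega
    · exact 𝓔.tetra_eq_zero' (hz _ _ (by omega)) _ _ _
  · intro hc; exact absurd (Finset.mem_range.mpr (by omega)) hc
  have s1 : 𝓔.tetra t t 1 1 (t + 1) (t + 1) = 𝓔.tetra (t + 1) (t + 1) t t 1 1 := by
    rw [tetra_swap_snd_thd, tetra_swap_fst_snd]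
  have s2 : 𝓔.tetra (t + 1) t 1 1 (t + 1) (t + 1) = 𝓔.tetra (t + 1) (t + 1) 1 1 (t + 1) t := by
    rw [tetra_swap_snd_thd, tetra_swap_fst_snd, tetra_swap_snd_thd]
  have s3 : 𝓔.tetra (t + 2) t 1 1 (t + 1) (t + 1) = 𝓔.tetra (t + 1) (t + 1) 1 1 (t + 2) t := by
    rw [tetra_swap_snd_thd, tetra_swap_fst_snd, tetra_swap_snd_thd]
  rw [s1, s2, s3, e2, e3] at e1
  have hsum := hcom.q_one_sum hd ht
  have hT := 𝓔.q_mul_mult_swap 1 (t + 1) t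
  rw [eq_sub_of_add_eq (eq_sub_of_add_eq e1), ← hsum]
  linear_combination 𝐍⁻¹ ^ 2 *
    (𝓔.q 1 (t + 2) (t + 1) + 𝓔.q 1 (t + 1) (t + 1)) * hT

end IdempotentOrdering

/-! ### The inequality for the first multiplicity -/

namespace IdempotentOrdering
variable {S : SymAssocScheme X d} (𝓔 : S.IdempotentOrdering)

/-- Writing `e_i(a)` for the column of `E_i` at `a`, this is the inner product of the `E_k`-components of `e_i(a) ∘ e_j(c)` and
`e_i(b) ∘ e_j(e)`. -/
def gram (i j k : ℕ) (a c b e : X) : ℝ :=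
  ∑ z, ∑ w, 𝓔.idem i z a * (𝓔.idem j z c * (𝓔.idem k z w * (𝓔.idem i w b * 𝓔.idem j w e)))

theorem gram_comm (i j k : ℕ) (a c b e : X) : 𝓔.gram i j k a c b e = 𝓔.gram i j k b e a c := by
  unfold gram
  rw [Finset.sum_comm]
  refine Finset.sum_congr rfl fun z _ => Finset.sum_congr rfl fun w _ => ?_
  rw [𝓔.idem_comm k w z]; ring

theorem gram_reproduce_fst (i j k : ℕ) (x c b e : X) :
    ∑ a, 𝓔.idem i x a * 𝓔.gram i j k a c b e = 𝓔.gram i j k x c b e := by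
  have := 𝓔.idem_reproduce i (fun z => ∑ w, 𝓔.idem j z c *
    (𝓔.idem k z w * (𝓔.idem i w b * 𝓔.idem j w e))) x
  simpa only [gram, Finset.mul_sum] using this

theorem gram_reproduce_snd (i j k : ℕ) (x a b e : X) :
    ∑ c, 𝓔.idem j x c * 𝓔.gram i j k a c b e = 𝓔.gram i j k a x b e := by
  have := 𝓔.idem_reproduce j (fun z => ∑ w, 𝓔.idem i z a *
    (𝓔.idem k z w * (𝓔.idem i w b * 𝓔.idem j w e))) x
  have h (c : X) : ∑ z, 𝓔.idem j z c * ∑ w, 𝓔.idem i z a *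
    (𝓔.idem k z w * (𝓔.idem i w b * 𝓔.idem j w e)) = 𝓔.gram i j k a c b e := by
    simp only [gram, Finset.mul_sum]
    exact Finset.sum_congr rfl fun _ _ => Finset.sum_congr rfl fun _ _ => by ring
  simpa only [h] using this

theorem gram_reproduce_thd (i j k : ℕ) (x a c e : X) :
    ∑ b, 𝓔.idem i x b * 𝓔.gram i j k a c b e = 𝓔.gram i j k a c x e := by
  simp only [𝓔.gram_comm i j k a c]
  exact 𝓔.gram_reproduce_fst i j k x e a c

theorem gram_reproduce_fth (i j k : ℕ) (x a c b : X) :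
    ∑ e, 𝓔.idem j x e * 𝓔.gram i j k a c b e = 𝓔.gram i j k a c b x := by
  simp only [𝓔.gram_comm i j k a c]
  exact 𝓔.gram_reproduce_snd i j k x b a c

/-- The inner product of `gram` with a function that is reproduced by `E_i`, `E_j`, `E_i`, `E_j` in
its four arguments. -/
theorem sum_gram_mul (i j k : ℕ) (H : X → X → X → X → ℝ)
    (h1 : ∀ x c b e, ∑ a, 𝓔.idem i x a * H a c b e = H x c b e)
    (h2 : ∀ x a b e, ∑ c, 𝓔.idem j x c * H a c b e = H a x b e)
    (h3 : ∀ x a c e, ∑ b, 𝓔.idem i x b * H a c b e = H a c x e)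
    (h4 : ∀ x a c b, ∑ e, 𝓔.idem j x e * H a c b e = H a c b x) :
    ∑ p : X × X × X × X, 𝓔.gram i j k p.1 p.2.1 p.2.2.1 p.2.2.2 * H p.1 p.2.1 p.2.2.1 p.2.2.2
      = ∑ z, ∑ w, 𝓔.idem k z w * H z z w w := by
  calc _ = ∑ p : X × X × X × X, ∑ s : X × X, 𝓔.idem k s.1 s.2 * (𝓔.idem i s.1 p.1 *
        (𝓔.idem j s.1 p.2.1 * (𝓔.idem i s.2 p.2.2.1 * (𝓔.idem j s.2 p.2.2.2 *
          H p.1 p.2.1 p.2.2.1 p.2.2.2)))) := by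
        refine Finset.sum_congr rfl fun p _ => ?_
        rw [Fintype.sum_prod_type, gram, Finset.sum_mul]
        refine Finset.sum_congr rfl fun z _ => ?_
        rw [Finset.sum_mul]
        exact Finset.sum_congr rfl fun w _ => by ring
    _ = _ := by
        rw [Finset.sum_comm]
        simp only [Fintype.sum_prod_type, ← Finset.mul_sum, h1, h2, h3, h4]

theorem gram_diag (i j k : ℕ) (z w : X) :
    𝓔.gram i j k z z w w = (𝐍⁻¹ * 𝓔.q i j k) ^ 2 * 𝓔.idem k z w := by
  have h (x y : X) : ∑ v, 𝓔.idem i v x * 𝓔.idem j v x * 𝓔.idem k v y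
      = 𝐍⁻¹ * 𝓔.q i j k * 𝓔.idem k x y := by
    have := congrFun (congrFun (𝓔.hadamard_mul_idem i j k) x) y
    simp only [Matrix.mul_apply, Matrix.hadamard_apply, Matrix.smul_apply, smul_eq_mul] at this
    rw [← this]
    exact Finset.sum_congr rfl fun v _ => by rw [𝓔.idem_comm i v x, 𝓔.idem_comm j v x]
  calc 𝓔.gram i j k z z w w
      = ∑ y, (𝓔.idem i y w * 𝓔.idem j y w) *
          ∑ v, 𝓔.idem i v z * 𝓔.idem j v z * 𝓔.idem k v y := by
        rw [gram, Finset.sum_comm]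
        refine Finset.sum_congr rfl fun y _ => ?_
        rw [Finset.mul_sum]
        exact Finset.sum_congr rfl fun _ _ => by ring
    _ = (𝐍⁻¹ * 𝓔.q i j k) * ∑ y, 𝓔.idem i y w * 𝓔.idem j y w * 𝓔.idem k y z := by
        rw [Finset.mul_sum]
        refine Finset.sum_congr rfl fun y _ => ?_
        rw [h, 𝓔.idem_comm k z y]; ring
    _ = _ := by rw [h, 𝓔.idem_comm k w z]; ring

theorem sum_gram_sq (i j k : ℕ) :
    ∑ p : X × X × X × X, 𝓔.gram i j k p.1 p.2.1 p.2.2.1 p.2.2.2 ^ 2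
      = (𝐍⁻¹ * 𝓔.q i j k) ^ 2 * 𝓔.mult k := by
  simp only [sq (𝓔.gram i j k _ _ _ _)]
  rw [𝓔.sum_gram_mul i j k (𝓔.gram i j k) (𝓔.gram_reproduce_fst i j k)
    (𝓔.gram_reproduce_snd i j k) (𝓔.gram_reproduce_thd i j k) (𝓔.gram_reproduce_fth i j k),
    mult_eq_sum_sq]
  simp only [gram_diag, Finset.mul_sum]
  exact Finset.sum_congr rfl fun _ _ => Finset.sum_congr rfl fun _ _ => by ring

theorem sum_gram_swap_sq (i j k : ℕ) :
    ∑ p : X × X × X × X, 𝓔.gram i j k p.2.2.1 p.2.1 p.1 p.2.2.2 ^ 2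
      = (𝐍⁻¹ * 𝓔.q i j k) ^ 2 * 𝓔.mult k := by
  rw [← sum_gram_sq]
  exact Fintype.sum_equiv
    (⟨fun p => (p.2.2.1, p.2.1, p.1, p.2.2.2), fun p => (p.2.2.1, p.2.1, p.1, p.2.2.2),
      fun _ => rfl, fun _ => rfl⟩ : X × X × X × X ≃ X × X × X × X) _ _ fun _ => rfl

theorem sum_gram_mul_gram_swap (i j k : ℕ) :
    ∑ p : X × X × X × X, 𝓔.gram i j k p.1 p.2.1 p.2.2.1 p.2.2.2 *
      𝓔.gram i j k p.2.2.1 p.2.1 p.1 p.2.2.2 = 𝓔.tetra k k j j i i := by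
  rw [𝓔.sum_gram_mul i j k (fun a c b e => 𝓔.gram i j k b c a e)
    (fun x c b e => 𝓔.gram_reproduce_thd i j k x b c e)
    (fun x a b e => 𝓔.gram_reproduce_snd i j k x b a e)
    (fun x a c e => 𝓔.gram_reproduce_fst i j k x c a e)
    (fun x a c b => 𝓔.gram_reproduce_fth i j k x b c a)]
  unfold tetra gram
  refine Finset.sum_congr rfl fun z _ => Finset.sum_congr rfl fun w _ => ?_
  simp only [Finset.mul_sum]
  refine Finset.sum_congr rfl fun x _ => Finset.sum_congr rfl fun y _ => ?_
  rw [𝓔.idem_comm i x w, 𝓔.idem_comm j x z, 𝓔.idem_comm i y z, 𝓔.idem_comm j y w]; ring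

theorem sum_gram_mul_idem (i j k : ℕ) :
    ∑ p : X × X × X × X, 𝓔.gram i j k p.1 p.2.1 p.2.2.1 p.2.2.2 *
      (𝓔.idem i p.1 p.2.2.1 * 𝓔.idem j p.2.1 p.2.2.2) = 𝐍⁻¹ * 𝓔.q i j k * 𝓔.mult k := by
  rw [𝓔.sum_gram_mul i j k (fun a c b e => 𝓔.idem i a b * 𝓔.idem j c e)]
  · rw [← sum_triple]
    exact Finset.sum_congr rfl fun _ _ => Finset.sum_congr rfl fun _ _ => by ring
  · intro x c b e
    rw [← 𝓔.sum_idem_mul_idem i x b, Finset.sum_mul]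
    exact Finset.sum_congr rfl fun _ _ => by ring
  · intro x a b e
    rw [← 𝓔.sum_idem_mul_idem j x e, Finset.mul_sum]
    exact Finset.sum_congr rfl fun _ _ => by ring
  · intro x a c e
    rw [𝓔.idem_comm i a x, ← 𝓔.sum_idem_mul_idem i x a, Finset.sum_mul]
    exact Finset.sum_congr rfl fun b _ => by rw [𝓔.idem_comm i a b]; ring
  · intro x a c b
    rw [𝓔.idem_comm j c x, ← 𝓔.sum_idem_mul_idem j x c, Finset.mul_sum]
    exact Finset.sum_congr rfl fun e _ => by rw [𝓔.idem_comm j c e]; ring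

theorem sum_gram_swap_mul_idem (i j k : ℕ) :
    ∑ p : X × X × X × X, 𝓔.gram i j k p.2.2.1 p.2.1 p.1 p.2.2.2 *
      (𝓔.idem i p.1 p.2.2.1 * 𝓔.idem j p.2.1 p.2.2.2) = 𝐍⁻¹ * 𝓔.q i j k * 𝓔.mult k := by
  rw [← sum_gram_mul_idem]
  refine Fintype.sum_equiv
    (⟨fun p => (p.2.2.1, p.2.1, p.1, p.2.2.2), fun p => (p.2.2.1, p.2.1, p.1, p.2.2.2),
      fun _ => rfl, fun _ => rfl⟩ : X × X × X × X ≃ X × X × X × X) _ _ fun p => ?_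
  simp only [Equiv.coe_fn_mk]
  rw [𝓔.idem_comm i p.1 p.2.2.1]

theorem sum_idem_mul_idem_sq (i j : ℕ) :
    ∑ p : X × X × X × X, (𝓔.idem i p.1 p.2.2.1 * 𝓔.idem j p.2.1 p.2.2.2) ^ 2
      = 𝓔.mult i * 𝓔.mult j := by
  rw [mult_eq_sum_sq, mult_eq_sum_sq]
  simp only [Fintype.sum_prod_type, mul_pow, ← Finset.mul_sum, ← Finset.sum_mul]

variable {𝓔}

/-- The key inequality. If `a_t^* = 0 = q_{2,t}^t`, all the inner products between `gram 1 t (t+1)`,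
its partial transpose, and the kernel of `E_1 ⊗ E_t` are known, and nonnegativity of the squared
norm of a suitable combination of the three reads `(m - b_t^*) (2 - m) ≥ 0`. -/
theorem IsCometric.mult_one_le_two (hcom : 𝓔.IsCometric) {t : ℕ} (ht0 : 1 ≤ t)
    (ht : t + 1 ≤ d) (ha : 𝓔.q 1 t t = 0) (h2 : 𝓔.q 2 t t = 0) : 𝓔.mult 1 ≤ 2 := by
  have hd : 1 ≤ d := by omega
  have hN := card_ne_zero S
  have hc : 𝓔.q 1 t (t + 1) = 1 := by
    refine hcom.q_one_eq_one hd ha h2 ht ?_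
    have := hcom.q_add_pos hd (i := 1) (j := t) (by omega)
    rw [Nat.add_comm 1 t] at this; exact this.ne'
  have hbm : 0 < 𝓔.mult 1 - 𝓔.q 1 (t + 1) t := by
    obtain ⟨s, rfl⟩ : ∃ s, t = s + 1 := ⟨t - 1, by omega⟩
    rw [← hcom.q_one_sum hd (j := s) (by omega), ha]
    have := hcom.q_add_pos hd (i := 1) (j := s) (by omega)
    rw [Nat.add_comm 1 s] at this
    linarith
  have hb : 0 < 𝓔.q 1 (t + 1) t := by
    have := hcom.q_sub_pos hd (i := 1) (j := t) (by omega)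
    rwa [Nat.add_comm 1 t] at this
  have hT := 𝓔.q_mul_mult_swap 1 t (t + 1)
  rw [hc, one_mul] at hT
  have hm := 𝓔.mult_pos hd
  have hmt := 𝓔.mult_pos (i := t) (by omega)
  have g1 := 𝓔.sum_gram_sq 1 t (t + 1)
  have g2 := 𝓔.sum_gram_swap_sq 1 t (t + 1)
  have g3 := 𝓔.sum_gram_mul_gram_swap 1 t (t + 1)
  have g4 := 𝓔.sum_gram_mul_idem 1 t (t + 1)
  have g5 := 𝓔.sum_gram_swap_mul_idem 1 t (t + 1)
  have g6 := 𝓔.sum_idem_mul_idem_sq 1 t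
  rw [hcom.tetra_mixed hd ht ha] at g3
  rw [hc] at g1 g2 g3 g4 g5
  rw [hT] at g1 g2 g4 g5
  generalize 𝓔.q 1 (t + 1) t = b at *
  generalize 𝓔.mult 1 = m at *
  generalize 𝓔.mult t = μ at *
  -- `2 b / m` is the coefficient for which the norm below is smallest
  have key : 0 ≤ ∑ p : X × X × X × X, (𝐍 * 𝓔.gram 1 t (t + 1) p.1 p.2.1 p.2.2.1 p.2.2.2 +
      𝐍 * 𝓔.gram 1 t (t + 1) p.2.2.1 p.2.1 p.1 p.2.2.2 -
      2 * b / m * (𝓔.idem 1 p.1 p.2.2.1 * 𝓔.idem t p.2.1 p.2.2.2)) ^ 2 :=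
    Finset.sum_nonneg fun _ _ => sq_nonneg _
  have expand (x y z : X × X × X × X → ℝ) (n l : ℝ) :
      ∑ p, (n * x p + n * y p - l * z p) ^ 2 = n ^ 2 * ∑ p, x p ^ 2 + n ^ 2 * ∑ p, y p ^ 2 +
        2 * n ^ 2 * ∑ p, x p * y p - 2 * l * n * ∑ p, x p * z p - 2 * l * n * ∑ p, y p * z p +
        l ^ 2 * ∑ p, z p ^ 2 := by
    simp only [Finset.mul_sum, ← Finset.sum_add_distrib, ← Finset.sum_sub_distrib]
    exact Finset.sum_congr rfl fun _ _ => by ring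
  rw [expand (fun p => 𝓔.gram 1 t (t + 1) p.1 p.2.1 p.2.2.1 p.2.2.2)
    (fun p => 𝓔.gram 1 t (t + 1) p.2.2.1 p.2.1 p.1 p.2.2.2)
    (fun p => 𝓔.idem 1 p.1 p.2.2.1 * 𝓔.idem t p.2.1 p.2.2.2), g1, g2, g3, g4, g5, g6] at key
  have key2 : 0 ≤ (2 * b * μ / m) * ((m - b) * (2 - m)) := by
    refine key.trans_eq ?_
    field_simp
    ring
  have h3 : 0 ≤ (m - b) * (2 - m) := nonneg_of_mul_nonneg_right key2 (by positivity)
  linarith [nonneg_of_mul_nonneg_right h3 hbm]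

end IdempotentOrdering

/-! ### The exceptional array with six classes -/

namespace IdempotentOrdering
variable {S : SymAssocScheme X d} {𝓔 : S.IdempotentOrdering}

theorem IsCometric.not_isExceptionalSix (hcom : 𝓔.IsCometric) (hm : 2 < 𝓔.firstMultiplicity) :
    ¬ 𝓔.IsExceptionalSix := by
  rintro ⟨h6, ⟨b₃, b₄, c₂, c₅, hK⟩, -⟩
  subst h6
  rw [𝓔.firstMultiplicity_eq (by norm_num)] at hm hK
  simp only [kreinArray, Prod.mk.injEq, List.range_succ_eq_map, List.range_zero, List.map_cons,
    List.map_nil, List.cons.injEq, b, c] at hK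
  simp at hK
  obtain ⟨⟨-, -, hb2, hb3, -, -⟩, -, -, hc3, hc4, -⟩ := hK
  have hs := hcom.q_one_sum (by norm_num) (j := 2) (by norm_num)
  norm_num at hs
  have ha : 𝓔.q 1 3 3 = 0 := by rw [hb3, hc3] at hs; linarith
  refine absurd (hcom.mult_one_le_two (t := 3) (by norm_num) (by norm_num) ha ?_) (not_le.mpr hm)
  have h0 := 𝓔.sum_q_mul_q 1 1 3 3
  simp only [Finset.sum_range_succ, Finset.sum_range_zero] at h0
  have z1 : 𝓔.q 1 1 3 = 0 := hcom.q_one_eq_zero (by norm_num) (by norm_num)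
  have z2 : 𝓔.q 1 1 4 = 0 := hcom.q_one_eq_zero (by norm_num) (by norm_num)
  have z3 : 𝓔.q 1 1 5 = 0 := hcom.q_one_eq_zero (by norm_num) (by norm_num)
  have z4 : 𝓔.q 1 1 6 = 0 := hcom.q_one_eq_zero (by norm_num) (by norm_num)
  have z5 : 𝓔.q 1 3 0 = 0 := hcom.q_one_eq_zero (by norm_num) (by norm_num)
  have z6 : 𝓔.q 1 3 1 = 0 := hcom.q_one_eq_zero (by norm_num) (by norm_num)
  have z7 : 𝓔.q 1 3 5 = 0 := hcom.q_one_eq_zero (by norm_num) (by norm_num)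
  have z8 : 𝓔.q 1 3 6 = 0 := hcom.q_one_eq_zero (by norm_num) (by norm_num)
  rw [z1, z2, z3, z4, z5, z6, z7, z8, ha, 𝓔.q_self_zero (i := 1) (by norm_num),
    𝓔.q_zero_left (by norm_num), if_pos rfl, 𝓔.q_comm 2 1 3, 𝓔.q_comm 4 1 3, hb2, hb3, hc3,
    hc4] at h0
  have hpos := hcom.q_add_pos (by norm_num) (i := 1) (j := 1) (by norm_num)
  refine (mul_eq_zero.mp ?_).resolve_left hpos.ne'
  linarith

end IdempotentOrdering

/-! ### Idempotents constant on the components of a graph -/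

namespace IdempotentOrdering
variable {S : SymAssocScheme X d} (𝓔 : S.IdempotentOrdering)

/-- The indices `h` for which the image of `E_h` consists of functions constant on the classes of
`r`. -/
def stable (r : X → X → Prop) : Set ℕ :=
  {h | ∀ x y z, r y z → 𝓔.idem h x y = 𝓔.idem h x z}

theorem zero_mem_stable (r : X → X → Prop) : 0 ∈ 𝓔.stable r := fun x y z _ => by
  rw [idem_zero_apply, idem_zero_apply]

variable {𝓔}

/-- `stable r` is closed under the entrywise product: functions constant on the classes of `r` form
an algebra. -/
theorem mem_stable_of_q_ne_zero {r : X → X → Prop} {i j l : ℕ} (hi : i ∈ 𝓔.stable r)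
    (hj : j ∈ 𝓔.stable r) (hq : 𝓔.q i j l ≠ 0) : l ∈ 𝓔.stable r := by
  intro x y z hyz
  have hN := card_ne_zero S
  have key (y : X) : (𝐍⁻¹ * 𝓔.q i j l) * 𝓔.idem l x y
      = ∑ w, 𝓔.idem l x w * (𝓔.idem i w y * 𝓔.idem j w y) := by
    have := congrFun (congrFun (𝓔.hadamard_mul_idem i j l) y) x
    simp only [Matrix.mul_apply, Matrix.hadamard_apply, Matrix.smul_apply, smul_eq_mul] at this
    rw [𝓔.idem_comm l x y, ← this]
    refine Finset.sum_congr rfl fun w _ => ?_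
    rw [𝓔.idem_comm l x w, 𝓔.idem_comm i w y, 𝓔.idem_comm j w y]; ring
  have h1 : (𝐍⁻¹ * 𝓔.q i j l) * 𝓔.idem l x y = (𝐍⁻¹ * 𝓔.q i j l) * 𝓔.idem l x z := by
    rw [key, key]
    exact Finset.sum_congr rfl fun w _ => by rw [hi w y z hyz, hj w y z hyz]
  exact mul_left_cancel₀ (mul_ne_zero (inv_ne_zero hN) hq) h1

variable (𝓔)

/-- For the components of a graph of the scheme, `E_h` annihilates the functions that are constant on
components unless its own image consists of such functions. -/
theorem sum_idem_mul_eq_zero {i : Fin (d + 1)} {f : X → ℝ}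
    (hf : ∀ y z, (S.graph i).Reachable y z → f y = f z) {h : ℕ}
    (hh : h ∉ 𝓔.stable (S.graph i).Reachable) (x : X) : ∑ y, 𝓔.idem h x y * f y = 0 := by
  rcases Nat.lt_or_ge d h with hd | hd
  · simp [𝓔.idem_of_gt hd]
  obtain ⟨g, hg⟩ := 𝓔.mem_boseMesner_eq_sum (Submodule.subset_span ⟨i, rfl⟩ : S.A i ∈ S.boseMesner)
  have hAcomm := S.boseMesner_apply_comm (Submodule.subset_span ⟨i, rfl⟩ : S.A i ∈ S.boseMesner)
  have hEA (k : Fin (d + 1)) : 𝓔.E k * S.A i = g k • 𝓔.E k := by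
    rw [hg]; simp [Finset.mul_sum, 𝓔.mul_eq]
  have hEA' (k : Fin (d + 1)) (x z : X) :
      ∑ y, 𝓔.idem k x y * S.A i y z = g k * 𝓔.idem k x z := by
    have := congrFun (congrFun (hEA k) x) z
    simpa [Matrix.mul_apply, 𝓔.idem_val] using this
  have hrow (z : X) : ∑ y, S.A i y z = g 0 := by
    have h1 := hEA' 0 z z
    simp only [Fin.val_zero, idem_zero_apply, ← Finset.mul_sum] at h1
    have hN := card_ne_zero S
    field_simp at h1
    exact h1
  have hA01 (y z : X) : S.A i y z = 0 ∨ (S.A i y z = 1 ∧ (S.graph i).Reachable y z) := by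
    obtain ⟨k, hk⟩ := S.exists_rel y z
    rw [S.A_apply_of_rel hk]
    by_cases hik : i = k
    · subst hik
      refine Or.inr ⟨if_pos rfl, ?_⟩
      by_cases hyz : y = z
      · rw [hyz]
      · exact SimpleGraph.Adj.reachable ⟨hyz, hk⟩
    · exact Or.inl (if_neg hik)
  have hAf (y : X) : ∑ z, S.A i y z * f z = g 0 * f y := by
    rw [← hrow y, Finset.sum_mul]
    refine Finset.sum_congr rfl fun z _ => ?_
    rw [hAcomm z y]
    rcases hA01 y z with h0 | ⟨-, h1⟩
    · rw [h0, zero_mul, zero_mul]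
    · rw [hf y z h1]
  have hval : ∃ k : Fin (d + 1), (k : ℕ) = h := ⟨⟨h, by omega⟩, rfl⟩
  obtain ⟨k, rfl⟩ := hval
  by_contra hne
  have h1 : g k * ∑ y, 𝓔.idem k x y * f y = g 0 * ∑ y, 𝓔.idem k x y * f y := by
    calc g k * ∑ y, 𝓔.idem k x y * f y
        = ∑ z, (∑ y, 𝓔.idem k x y * S.A i y z) * f z := by
          rw [Finset.mul_sum]
          exact Finset.sum_congr rfl fun z _ => by rw [hEA']; ring
      _ = ∑ y, 𝓔.idem k x y * ∑ z, S.A i y z * f z := by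
          simp only [Finset.sum_mul, Finset.mul_sum]
          rw [Finset.sum_comm]
          exact Finset.sum_congr rfl fun y _ => Finset.sum_congr rfl fun z _ => by ring
      _ = _ := by
          rw [Finset.mul_sum]
          exact Finset.sum_congr rfl fun y _ => by rw [hAf]; ring
  have hgk : g k = g 0 := mul_right_cancel₀ hne h1
  refine hh fun w y z hyz => ?_
  -- the Laplacian form of a row of `E_k` vanishes
  have hlap : ∑ y, ∑ z, S.A i y z * (𝓔.idem k w y - 𝓔.idem k w z) ^ 2 = 0 := by
    have e1 : ∑ y, ∑ z, S.A i y z * 𝓔.idem k w y ^ 2 = g 0 * ∑ y, 𝓔.idem k w y ^ 2 := by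
      rw [Finset.mul_sum]
      refine Finset.sum_congr rfl fun y _ => ?_
      rw [← Finset.sum_mul, ← hrow y]
      exact congrArg (· * _) (Finset.sum_congr rfl fun z _ => hAcomm y z)
    have e2 : ∑ y, ∑ z, S.A i y z * 𝓔.idem k w z ^ 2 = g 0 * ∑ y, 𝓔.idem k w y ^ 2 := by
      rw [Finset.sum_comm, Finset.mul_sum]
      refine Finset.sum_congr rfl fun y _ => ?_
      rw [← Finset.sum_mul, ← hrow y]
    have e3 : ∑ y, ∑ z, 𝓔.idem k w y * S.A i y z * 𝓔.idem k w z
        = g 0 * ∑ y, 𝓔.idem k w y ^ 2 := by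
      rw [Finset.sum_comm, Finset.mul_sum]
      refine Finset.sum_congr rfl fun y _ => ?_
      rw [← Finset.sum_mul, hEA', hgk]; ring
    calc _ = ∑ y, ∑ z, S.A i y z * 𝓔.idem k w y ^ 2 + ∑ y, ∑ z, S.A i y z * 𝓔.idem k w z ^ 2
          - 2 * ∑ y, ∑ z, 𝓔.idem k w y * S.A i y z * 𝓔.idem k w z := by
          simp only [Finset.mul_sum, ← Finset.sum_add_distrib, ← Finset.sum_sub_distrib]
          exact Finset.sum_congr rfl fun _ _ => Finset.sum_congr rfl fun _ _ => by ring
      _ = 0 := by rw [e1, e2, e3]; ring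
  have hnn (y z : X) : 0 ≤ S.A i y z * (𝓔.idem k w y - 𝓔.idem k w z) ^ 2 := by
    rcases hA01 y z with h0 | ⟨h1, -⟩
    · rw [h0, zero_mul]
    · rw [h1, one_mul]; positivity
  have hadj (y z : X) (hyz : (S.graph i).Adj y z) : 𝓔.idem k w y = 𝓔.idem k w z := by
    rw [Finset.sum_eq_zero_iff_of_nonneg (fun y _ => Finset.sum_nonneg fun z _ => hnn y z)] at hlap
    have h2 := hlap y (Finset.mem_univ _)
    rw [Finset.sum_eq_zero_iff_of_nonneg (fun z _ => hnn y z)] at h2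
    have h3 := h2 z (Finset.mem_univ _)
    rw [S.A_apply_of_rel hyz.2, if_pos rfl, one_mul] at h3
    linarith [pow_eq_zero_iff (two_ne_zero) |>.mp h3]
  obtain ⟨p⟩ := hyz
  induction p with
  | nil => rfl
  | cons hvw _ ih => exact (hadj _ _ hvw).trans ih

theorem exists_mem_stable {i : Fin (d + 1)} (hc : ¬ (S.graph i).Connected) :
    ∃ h, 1 ≤ h ∧ h ≤ d ∧ h ∈ 𝓔.stable (S.graph i).Reachable := by
  classical
  by_contra! hno
  obtain ⟨x₀, -⟩ := S.nonempty 0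
  have : Nonempty X := ⟨x₀⟩
  refine hc ((S.graph i).connected_iff.mpr ⟨fun u v => ?_, this⟩)
  by_contra huv
  let f : X → ℝ := fun y => if (S.graph i).Reachable u y then 1 else 0
  have hf (y z : X) (hyz : (S.graph i).Reachable y z) : f y = f z := by
    have : (S.graph i).Reachable u y ↔ (S.graph i).Reachable u z :=
      ⟨fun h => h.trans hyz, fun h => h.trans hyz.symm⟩
    simp only [f, this]
  have key (x : X) : f x = 𝐍⁻¹ * ∑ y, f y := by
    have h1 : f x = ∑ h ∈ Finset.range (d + 1), ∑ y, 𝓔.idem h x y * f y := by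
      rw [Finset.sum_comm]
      have h2 (y : X) : ∑ h ∈ Finset.range (d + 1), 𝓔.idem h x y * f y
          = if x = y then f y else 0 := by
        rw [← Finset.sum_mul, ← Matrix.sum_apply, 𝓔.sum_idem, Matrix.one_apply]
        split_ifs <;> simp
      simp only [h2, Finset.sum_ite_eq, Finset.mem_univ, if_true]
    rw [h1, Finset.sum_eq_single 0, Finset.mul_sum]
    · exact Finset.sum_congr rfl fun y _ => by rw [idem_zero_apply]
    · intro h hh h0
      exact 𝓔.sum_idem_mul_eq_zero hf
        (hno h (Nat.one_le_iff_ne_zero.mpr h0) (Nat.lt_succ_iff.mp (Finset.mem_range.mp hh))) x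
    · intro h; simp at h
  have h1 : f u = 1 := if_pos (SimpleGraph.Reachable.refl u)
  have h2 : f v = 0 := if_neg huv
  have h3 := key u
  rw [← key v, h1, h2] at h3
  exact one_ne_zero h3

variable {𝓔}

theorem IsCometric.one_notMem_stable (hcom : 𝓔.IsCometric) (hd : 1 ≤ d) {r : X → X → Prop} {y z : X}
    (hyz : y ≠ z) (hr : r y z) : 1 ∉ 𝓔.stable r := by
  intro h1
  have hall (h : ℕ) (hh : h ≤ d) : h ∈ 𝓔.stable r := by
    induction h with
    | zero => exact 𝓔.zero_mem_stable r
    | succ k ih =>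
      refine mem_stable_of_q_ne_zero h1 (ih (by omega)) ?_
      have := hcom.q_add_pos hd (i := 1) (j := k) (by omega)
      rw [Nat.add_comm 1 k] at this
      exact this.ne'
  have h2 : (1 : Matrix X X ℝ) y y = (1 : Matrix X X ℝ) y z := by
    rw [← 𝓔.sum_idem, Matrix.sum_apply, Matrix.sum_apply]
    exact Finset.sum_congr rfl fun h hh =>
      hall h (Nat.lt_succ_iff.mp (Finset.mem_range.mp hh)) y y z hr
  rw [Matrix.one_apply_eq, Matrix.one_apply_ne hyz] at h2
  exact one_ne_zero h2

end IdempotentOrdering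

theorem exists_ne_reachable (S : SymAssocScheme X d) {i : Fin (d + 1)} (hi : i ≠ 0) :
    ∃ y z, y ≠ z ∧ (S.graph i).Reachable y z := by
  obtain ⟨y, z, hyz⟩ := S.nonempty i
  have hne : y ≠ z := by
    rintro rfl
    have h1 := congrFun (congrFun S.as1 y) y
    have h2 := S.A_apply_of_rel (j := 0) hyz
    rw [if_neg hi.symm] at h2
    simp only [A] at h2
    rw [h1] at h2
    simp at h2
  exact ⟨y, z, hne, SimpleGraph.Adj.reachable ⟨hne, hyz⟩⟩

/-! ### The dual antipodal case -/

namespace IdempotentOrdering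
variable {S : SymAssocScheme X d} {𝓔 : S.IdempotentOrdering}

theorem q_ne_zero_swap {i j h : ℕ} (hq : 𝓔.q i j h ≠ 0) : 𝓔.q i h j ≠ 0 :=
  fun h0 => hq (𝓔.q_eq_zero_swap h0)

theorem q_ne_zero_rotate {i j h : ℕ} (hq : 𝓔.q i j h ≠ 0) : 𝓔.q j h i ≠ 0 :=
  q_ne_zero_swap (by rwa [𝓔.q_comm])

/-- If `{0, d}` is closed, then `E_d ∘ E_i` only involves `E_i` and `E_{d-i}`. -/
theorem IsCometric.q_last_eq_zero (hcom : 𝓔.IsCometric) (hd : 1 ≤ d)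
    (hdd : ∀ l, 𝓔.q d d l ≠ 0 → l = 0 ∨ l = d) {i j : ℕ} (hi : i ≤ d) (hj : j ≤ d)
    (hij : j ≠ i) (hij' : i + j ≠ d) : 𝓔.q d i j = 0 := by
  have tri {i j : ℕ} (h : 𝓔.q d i j ≠ 0) : d ≤ i + j := by
    by_contra hlt
    exact q_ne_zero_rotate h (hcom.q_eq_zero hd (by omega))
  -- the relation `i = k ∨ q d i k ≠ 0` is transitive
  have trans {i j k : ℕ} (hi : i ≤ d) (h1 : 𝓔.q d i j ≠ 0) (h2 : 𝓔.q d j k ≠ 0) (hik : i ≠ k) :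
      𝓔.q d i k ≠ 0 := by
    intro h0
    have hj : j < d + 1 := by
      by_contra hc
      exact h1 (𝓔.q_of_gt_right (by omega) _ _)
    have e := 𝓔.sum_q_mul_q d i d k
    have hr : ∑ l ∈ Finset.range (d + 1), 𝓔.q d d l * 𝓔.q l i k = 0 := by
      refine Finset.sum_eq_zero fun l _ => ?_
      by_cases hl : 𝓔.q d d l = 0
      · rw [hl, zero_mul]
      rcases hdd l hl with rfl | rfl
      · rw [𝓔.q_zero_left hi, if_neg hik, mul_zero]
      · rw [h0, mul_zero]
    rw [hr, Finset.sum_eq_zero_iff_of_nonneg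
      (fun l _ => mul_nonneg (𝓔.q_nonneg _ _ _) (𝓔.q_nonneg _ _ _))] at e
    have := e j (Finset.mem_range.mpr hj)
    rw [𝓔.q_comm j d k] at this
    exact (mul_ne_zero h1 h2) this
  by_contra hq
  have hge := tri hq
  have ext {j : ℕ} (hj : j ≤ d) : 𝓔.q d j (d - j) ≠ 0 := by
    have := hcom.q_sub_pos hd (i := j) (j := d - j) (by omega)
    rw [Nat.add_sub_cancel' hj, 𝓔.q_comm] at this
    exact this.ne'
  have h1 := tri (trans hi hq (ext hj) (by omega))
  have h2 := tri (trans hj (q_ne_zero_swap hq) (ext hi) (by omega))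
  omega

theorem sum_range_eq_two {f : ℕ → ℝ} {i j : ℕ} (hij : i ≠ j) (hi : i ≤ d) (hj : j ≤ d)
    (hz : ∀ l ≤ d, l ≠ i → l ≠ j → f l = 0) :
    ∑ l ∈ Finset.range (d + 1), f l = f i + f j :=
  Finset.sum_eq_add i j hij
    (fun l hl h => hz l (Nat.lt_succ_iff.mp (Finset.mem_range.mp hl)) h.1 h.2)
    (fun h => absurd (Finset.mem_range.mpr (by omega)) h)
    (fun h => absurd (Finset.mem_range.mpr (by omega)) h)

theorem IsCometric.q_last_add (hcom : 𝓔.IsCometric) (hd : 1 ≤ d)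
    (hdd : ∀ l, 𝓔.q d d l ≠ 0 → l = 0 ∨ l = d) {i i' : ℕ} (hi : i + i' = d) (hne : i ≠ i') :
    𝓔.q d i i + 𝓔.q d i' i = 𝓔.mult d := by
  rw [← 𝓔.sum_q_mid d (show i ≤ d by omega), sum_range_eq_two hne (by omega) (by omega)]
  intro l hl h1 h2
  exact hcom.q_last_eq_zero hd hdd hl (by omega) (Ne.symm h1) (by omega)

/-- The matrix of `E_0 + E_d` under the entrywise product has rank one on `{i, d - i}`. -/
theorem IsCometric.q_last_symm (hcom : 𝓔.IsCometric) (hd : 1 ≤ d)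
    (hdd : ∀ l, 𝓔.q d d l ≠ 0 → l = 0 ∨ l = d) {i i' : ℕ} (hi : i + i' = d) (hne : i ≠ i') :
    𝓔.q d i i' = 1 + 𝓔.q d i i := by
  have hsum := hcom.q_last_add hd hdd hi hne
  have hdd1 : 𝓔.q d d d = 𝓔.mult d - 1 := by
    have := hcom.q_last_add hd hdd (i := d) (i' := 0) (by omega) (by omega)
    rw [𝓔.q_comm d 0 d, 𝓔.q_zero_left le_rfl, if_pos rfl] at this
    linarith
  have e := 𝓔.sum_q_mul_q d i d i
  rw [sum_range_eq_two hne (by omega) (by omega), sum_range_eq_two (i := 0) (j := d) (by omega)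
    (by omega) le_rfl, 𝓔.q_self_zero le_rfl, 𝓔.q_zero_left (by omega), if_pos rfl, hdd1,
    𝓔.q_comm i d i, 𝓔.q_comm i' d i] at e
  · have hpos : 𝓔.q d i' i ≠ 0 := by
      have := hcom.q_sub_pos hd (i := i') (j := i) (by omega)
      rw [Nat.add_comm i' i, hi, 𝓔.q_comm] at this
      exact this.ne'
    refine mul_right_cancel₀ hpos ?_
    linear_combination e - (1 + 𝓔.q d i i) * hsum
  · intro l hl h1 h2
    by_contra hc
    rcases hdd l (left_ne_zero_of_mul hc) with h | h <;> omega
  · intro l hl h1 h2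
    rw [hcom.q_last_eq_zero hd hdd (by omega) hl h1 (by omega), zero_mul]

/-- If `{0, d}` is closed, multiplication by `E_1` respects the sums `E_i + E_{d-i}`, and comparing
coefficients gives the dual antipodal relations. -/
theorem IsCometric.isQAntipodal (hcom : 𝓔.IsCometric) (hd : 1 ≤ d)
    (hdd : ∀ l, 𝓔.q d d l ≠ 0 → l = 0 ∨ l = d) : 𝓔.IsQAntipodal := by
  intro h hh hne
  rcases Nat.lt_or_ge h d with hlt | hge
  swap
  · have : h = d := by omega
    subst this
    rw [Nat.sub_self, c, if_pos rfl, b]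
    exact 𝓔.q_of_gt_mid (by omega) _ _
  obtain ⟨i, rfl⟩ : ∃ i, d = h + 1 + i := ⟨d - h - 1, by omega⟩
  have hsub : h + 1 + i - h = i + 1 := by omega
  rw [c, hsub, if_neg (by omega), b, Nat.add_sub_cancel]
  have hk : i + 1 ≠ h := by omega
  have comm (k k' : ℕ) (hkk : k + k' = h + 1 + i) (hkne : k ≠ k') :
      ∑ l ∈ Finset.range (h + 1 + i + 1), 𝓔.q (h + 1 + i) i l * 𝓔.q 1 l k
        = 𝓔.q 1 i k * 𝓔.q (h + 1 + i) k k + 𝓔.q 1 i k' * (1 + 𝓔.q (h + 1 + i) k' k') := by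
    have e := 𝓔.sum_q_mul_q i (h + 1 + i) 1 k
    rw [sum_range_eq_two (f := fun l => 𝓔.q i 1 l * 𝓔.q l (h + 1 + i) k) hkne (by omega)
      (by omega)] at e
    · rw [← hcom.q_last_symm hd hdd (i := k') (i' := k) (by omega) hkne.symm, 𝓔.q_comm 1 i k,
        𝓔.q_comm 1 i k', 𝓔.q_comm _ k k, 𝓔.q_comm _ k' k, ← e]
      exact Finset.sum_congr rfl fun l _ => by rw [𝓔.q_comm _ i l, 𝓔.q_comm 1 l k]
    · intro l hl h1 h2
      rw [𝓔.q_comm l _ k, hcom.q_last_eq_zero hd hdd hl (by omega) (Ne.symm h1) (by omega), mul_zero]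
  have c1 := comm (i + 1) h (by omega) hk
  have c2 := comm h (i + 1) (by omega) hk.symm
  have hnn := 𝓔.q_nonneg (h + 1 + i) i i
  by_cases hih : i = h + 1
  · subst hih
    have single (k : ℕ) : ∑ l ∈ Finset.range (h + 1 + (h + 1) + 1),
        𝓔.q (h + 1 + (h + 1)) (h + 1) l * 𝓔.q 1 l k
        = 𝓔.q (h + 1 + (h + 1)) (h + 1) (h + 1) * 𝓔.q 1 (h + 1) k := by
      refine Finset.sum_eq_single _ (fun l hl h1 => ?_) fun hc =>
        absurd (Finset.mem_range.mpr (by omega)) hc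
      rw [hcom.q_last_eq_zero hd hdd (by omega) (Nat.lt_succ_iff.mp (Finset.mem_range.mp hl)) h1
        (by omega), zero_mul]
    rw [single] at c1 c2
    refine mul_left_cancel₀ (show 1 + 𝓔.q (h + 1 + (h + 1)) (h + 1) (h + 1) ≠ 0 by positivity) ?_
    linear_combination c2 - c1
  · have two (k : ℕ) : ∑ l ∈ Finset.range (h + 1 + i + 1), 𝓔.q (h + 1 + i) i l * 𝓔.q 1 l k
        = 𝓔.q (h + 1 + i) i i * 𝓔.q 1 i k + (1 + 𝓔.q (h + 1 + i) i i) * 𝓔.q 1 (h + 1) k := by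
      rw [sum_range_eq_two (i := i) (j := h + 1) hih (by omega) (by omega),
        hcom.q_last_symm hd hdd (by omega) hih]
      intro l hl h1 h2
      rw [hcom.q_last_eq_zero hd hdd (by omega) hl h1 (by omega), zero_mul]
    have z1 : 𝓔.q 1 i h = 0 := hcom.q_one_eq_zero hd (by omega)
    have z2 : 𝓔.q 1 (h + 1) (i + 1) = 0 := hcom.q_one_eq_zero hd (by omega)
    rw [two, z1] at c1 c2
    rw [z2] at c1
    refine mul_left_cancel₀ (show 1 + 𝓔.q (h + 1 + i) i i ≠ 0 by positivity) ?_
    linear_combination c2 - c1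

end IdempotentOrdering

/-! ### The dual bipartite case -/

namespace IdempotentOrdering
variable {S : SymAssocScheme X d} {𝓔 : S.IdempotentOrdering}

theorem IsCometric.card_mul_idem_one_lt (hcom : 𝓔.IsCometric) (hd : 1 ≤ d) {x y : X}
    (hxy : x ≠ y) : 𝐍 * 𝓔.idem 1 x y < 𝓔.mult 1 := by
  have hN := card_pos S
  have hsq (x y : X) : ∑ z, 𝓔.idem 1 x z * 𝓔.idem 1 y z = 𝓔.idem 1 x y := by
    rw [← 𝓔.sum_idem_mul_idem]
    exact Finset.sum_congr rfl fun z _ => by rw [𝓔.idem_comm 1 y z]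
  refine lt_of_le_of_ne ?_ fun heq => hxy ?_
  · have h1 : 0 ≤ ∑ z, (𝓔.idem 1 x z - 𝓔.idem 1 y z) ^ 2 :=
      Finset.sum_nonneg fun _ _ => sq_nonneg _
    have h2 : ∑ z, (𝓔.idem 1 x z - 𝓔.idem 1 y z) ^ 2
        = 𝓔.idem 1 x x + 𝓔.idem 1 y y - 2 * 𝓔.idem 1 x y := by
      rw [← hsq x x, ← hsq y y, ← hsq x y, Finset.mul_sum, ← Finset.sum_add_distrib,
        ← Finset.sum_sub_distrib]
      exact Finset.sum_congr rfl fun _ _ => by ring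
    rw [h2] at h1
    have h3 := 𝓔.idem_diag 1 x
    have h4 := 𝓔.idem_diag 1 y
    have h5 := mul_nonneg hN.le h1
    linarith
  · obtain ⟨k, hk⟩ := S.exists_rel x y
    obtain ⟨l, hl⟩ := S.exists_rel x x
    have h1 : 𝓔.Q k 1 = 𝓔.Q l 1 := by
      rw [← 𝓔.card_mul_idem_one_apply hd hk, ← 𝓔.card_mul_idem_one_apply hd hl, heq, 𝓔.idem_diag]
    have h2 : k = l := 𝓔.Q_one_injective hcom h1
    subst h2
    have h3 (u v : X) : S.A 0 u v = if u = v then 1 else 0 := by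
      rw [A, S.as1, Matrix.one_apply]
    have h4 : S.A 0 x y = S.A 0 x x := by rw [S.A_apply_of_rel hk, S.A_apply_of_rel hl]
    by_contra hne
    rw [h3, h3, if_neg hne, if_pos rfl] at h4
    exact zero_ne_one h4

/-- `E_1 ∘ E_1` is a combination of `E_0`, `E_1`, `E_2`: if `E_2` is constant on the classes of `r`,
so is a quadratic expression in the entries of `E_1`. -/
theorem IsCometric.quadratic_const (hcom : 𝓔.IsCometric) (hd : 1 ≤ d) {r : X → X → Prop}
    (h2 : 2 ∈ 𝓔.stable r) {x y z : X} (hyz : r y z) :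
    (𝐍 * 𝓔.idem 1 x y) ^ 2 - 𝓔.q 1 1 1 * (𝐍 * 𝓔.idem 1 x y)
      = (𝐍 * 𝓔.idem 1 x z) ^ 2 - 𝓔.q 1 1 1 * (𝐍 * 𝓔.idem 1 x z) := by
  have hN := card_ne_zero S
  have key (y : X) : (𝐍 * 𝓔.idem 1 x y) ^ 2 - 𝓔.q 1 1 1 * (𝐍 * 𝓔.idem 1 x y)
      = 𝓔.q 1 1 0 + 𝓔.q 1 1 2 * (𝐍 * 𝓔.idem 2 x y) := by
    have h1 := congrFun (congrFun (𝓔.idem_hadamard_idem 1 1) x) y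
    simp only [Matrix.hadamard_apply, Matrix.smul_apply, Matrix.sum_apply, smul_eq_mul] at h1
    rw [sum_range_eq_three 0 (fun l h1 h2 h3 => by
        rw [hcom.q_eq_zero hd (by omega), zero_mul])
      (fun l hl => by rw [𝓔.idem_of_gt hl]; simp), idem_zero_apply] at h1
    have h3 : 𝐍 ^ 2 * (𝓔.idem 1 x y * 𝓔.idem 1 x y) = 𝐍 * (𝓔.q 1 1 0 * 𝐍⁻¹ +
        𝓔.q 1 1 1 * 𝓔.idem 1 x y + 𝓔.q 1 1 2 * 𝓔.idem 2 x y) := by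
      rw [h1]; field_simp
    have h4 : 𝐍 * 𝐍⁻¹ = 1 := mul_inv_cancel₀ hN
    linear_combination h3 + 𝓔.q 1 1 0 * h4
  rw [key, key, h2 x y z hyz]

/-- If the classes of `r` are such that `E_2` is constant and `E_1` sums to zero on them, then
`a_1^* = 0`, unless `d ≤ 2`. For `a_1^* ≠ 0` the quadratic equation leaves only the values `m`,
`a_1^* - m` and `0` for the dual eigenvalues. -/
theorem IsCometric.q_one_one_one_eq_zero (hcom : 𝓔.IsCometric) (hd : 3 ≤ d) {r : X → X → Prop}
    (hr : Equivalence r) (h2 : 2 ∈ 𝓔.stable r) [∀ u, DecidablePred (r u)]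
    (hsum : ∀ x u, ∑ y with r u y, 𝓔.idem 1 x y = 0) : 𝓔.q 1 1 1 = 0 := by
  have hd1 : 1 ≤ d := by omega
  have hm := 𝓔.mult_pos hd1
  by_contra ha
  have hpos : 0 < 𝓔.q 1 1 1 := lt_of_le_of_ne (𝓔.q_nonneg _ _ _) (Ne.symm ha)
  have hsum' (x u : X) : ∑ y with r u y, 𝐍 * 𝓔.idem 1 x y = 0 := by
    rw [← Finset.mul_sum, hsum, mul_zero]
  have hown (x y : X) (hxy : r x y) (hne : x ≠ y) :
      𝐍 * 𝓔.idem 1 x y = 𝓔.q 1 1 1 - 𝓔.mult 1 := by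
    have h3 := hcom.quadratic_const hd1 h2 (x := x) hxy
    rw [𝓔.idem_diag] at h3
    have h4 : (𝐍 * 𝓔.idem 1 x y - 𝓔.mult 1) *
        (𝐍 * 𝓔.idem 1 x y - (𝓔.q 1 1 1 - 𝓔.mult 1)) = 0 := by linear_combination -h3
    rcases mul_eq_zero.mp h4 with h5 | h5
    · exact absurd (sub_eq_zero.mp h5) (hcom.card_mul_idem_one_lt hd1 hne).ne
    · exact sub_eq_zero.mp h5
  -- all the classes have the same size, the solution `n` of `(n - 1) (m - a₁) = m`
  have hcard (x : X) : (((Finset.univ.filter (r x)).card : ℝ) - 1) *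
      (𝓔.mult 1 - 𝓔.q 1 1 1) = 𝓔.mult 1 := by
    have hx : x ∈ Finset.univ.filter (r x) := by simp [hr.refl x]
    have h3 := hsum' x x
    rw [← Finset.add_sum_erase _ _ hx, 𝓔.idem_diag, Finset.sum_congr rfl (g := fun _ =>
      𝓔.q 1 1 1 - 𝓔.mult 1), Finset.sum_const, nsmul_eq_mul, Finset.card_erase_of_mem hx,
      Nat.cast_sub (Finset.card_pos.mpr ⟨x, hx⟩)] at h3
    · push_cast at h3; linarith
    · intro y hy
      obtain ⟨hy1, hy2⟩ := Finset.mem_erase.mp hy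
      exact hown x y (Finset.mem_filter.mp hy2).2 hy1.symm
  have hma : 0 < 𝓔.mult 1 - 𝓔.q 1 1 1 := by
    obtain ⟨x, -⟩ := S.nonempty 0
    have hx : x ∈ Finset.univ.filter (r x) := by simp [hr.refl x]
    have h1 : (1 : ℝ) ≤ (Finset.univ.filter (r x)).card := by
      exact_mod_cast Finset.card_pos.mpr ⟨x, hx⟩
    by_contra hc
    have := mul_nonpos_of_nonneg_of_nonpos (sub_nonneg.mpr h1) (not_lt.mp hc)
    rw [hcard x] at this
    linarith
  have hother (x y : X) (hxy : ¬ r x y) : 𝓔.idem 1 x y = 0 := by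
    by_contra hne
    have hne' : 𝐍 * 𝓔.idem 1 x y ≠ 0 := mul_ne_zero (card_ne_zero S) hne
    obtain ⟨y₁, hy₁, hp⟩ := Finset.exists_pos_of_sum_zero_of_exists_nonzero _ (hsum' x y)
      ⟨y, by simp [hr.refl y], hne'⟩
    have hyy₁ : r y y₁ := (Finset.mem_filter.mp hy₁).2
    have hxy₁ : x ≠ y₁ := by
      rintro rfl; exact hxy (hr.symm hyy₁)
    have hlt := hcom.card_mul_idem_one_lt hd1 hxy₁
    have hval (z : X) (hz : z ∈ Finset.univ.filter (r y)) :
        𝐍 * 𝓔.idem 1 x z = 𝐍 * 𝓔.idem 1 x y₁ ∨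
          𝐍 * 𝓔.idem 1 x z = 𝓔.q 1 1 1 - 𝐍 * 𝓔.idem 1 x y₁ := by
      have h3 := hcom.quadratic_const hd1 h2 (x := x)
        (hr.trans (hr.symm hyy₁) (Finset.mem_filter.mp hz).2)
      have h4 : (𝐍 * 𝓔.idem 1 x z - 𝐍 * 𝓔.idem 1 x y₁) *
        (𝐍 * 𝓔.idem 1 x z - (𝓔.q 1 1 1 - 𝐍 * 𝓔.idem 1 x y₁)) = 0 := by linear_combination -h3
      rcases mul_eq_zero.mp h4 with h5 | h5
      · exact Or.inl (sub_eq_zero.mp h5)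
      · exact Or.inr (sub_eq_zero.mp h5)
    have hs := hsum' x y
    have hn := hcard y
    generalize hpdef : 𝐍 * 𝓔.idem 1 x y₁ = p at *
    -- a sum of values `p > 0` and `a₁ - p` that vanishes, on a class of `n` points, needs
    -- `p ≤ (n - 1) (p - a₁)`, which fails for `p < m`
    by_cases hp2 : 𝓔.q 1 1 1 - p ≤ p
    · rw [← Finset.add_sum_erase _ _ hy₁, hpdef] at hs
      have h3 : ∑ _z ∈ (Finset.univ.filter (r y)).erase y₁, (𝓔.q 1 1 1 - p)
          ≤ ∑ z ∈ (Finset.univ.filter (r y)).erase y₁, 𝐍 * 𝓔.idem 1 x z := by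
        refine Finset.sum_le_sum fun z hz => ?_
        rcases hval z (Finset.mem_of_mem_erase hz) with h4 | h4
        · rw [h4]; exact hp2
        · exact h4.ge
      rw [Finset.sum_const, nsmul_eq_mul, Finset.card_erase_of_mem hy₁,
        Nat.cast_sub (Finset.card_pos.mpr ⟨y₁, hy₁⟩), Nat.cast_one] at h3
      have h4 : p * (𝓔.mult 1 - 𝓔.q 1 1 1) ≤ (((Finset.univ.filter (r y)).card : ℝ) - 1) *
          (𝓔.mult 1 - 𝓔.q 1 1 1) * (p - 𝓔.q 1 1 1) := by
        rw [mul_right_comm]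
        refine mul_le_mul_of_nonneg_right ?_ hma.le
        linarith
      rw [hn] at h4
      have h5 : 𝓔.q 1 1 1 * p < 𝓔.q 1 1 1 * 𝓔.mult 1 := mul_lt_mul_of_pos_left hlt hpos
      linarith
    · refine hs.not_gt (Finset.sum_pos (fun z hz => ?_) ⟨y₁, hy₁⟩)
      rcases hval z hz with h4 | h4 <;> rw [h4] <;> linarith
  have hrange : Finset.univ.image (fun k => 𝓔.Q k 1)
      ⊆ {𝓔.mult 1, 𝓔.q 1 1 1 - 𝓔.mult 1, 0} := by
    intro t ht
    obtain ⟨k, -, rfl⟩ := Finset.mem_image.mp ht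
    obtain ⟨x, y, hxy⟩ := S.nonempty k
    rw [← 𝓔.card_mul_idem_one_apply hd1 hxy]
    simp only [Finset.mem_insert, Finset.mem_singleton]
    by_cases hrxy : r x y
    · by_cases hne : x = y
      · subst hne; exact Or.inl (𝓔.idem_diag 1 x)
      · exact Or.inr (Or.inl (hown x y hrxy hne))
    · rw [hother x y hrxy]; simp
  have hc := (Finset.card_le_card hrange).trans Finset.card_le_three
  rw [Finset.card_image_of_injective _ (𝓔.Q_one_injective hcom), Finset.card_univ,
    Fintype.card_fin] at hc
  omega

/-- If `a_1^* = 0` in the preceding situation, the classes of `r` have size two. -/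
theorem IsCometric.class_eq_pair (hcom : 𝓔.IsCometric) (hd : 1 ≤ d) {r : X → X → Prop}
    (hr : Equivalence r) (h2 : 2 ∈ 𝓔.stable r) [∀ u, DecidablePred (r u)]
    (hsum : ∀ x u, ∑ y with r u y, 𝓔.idem 1 x y = 0) (ha : 𝓔.q 1 1 1 = 0) {y z : X}
    (hyz : r y z) (hne : y ≠ z) : Finset.univ.filter (r y) = {y, z} := by
  have hm := 𝓔.mult_pos hd
  have hN := card_ne_zero S
  have hy : y ∈ Finset.univ.filter (r y) := by simp [hr.refl y]
  have hz : z ∈ Finset.univ.filter (r y) := by simp [hyz]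
  have hown (w : X) (hw : w ∈ (Finset.univ.filter (r y)).erase y) :
      𝐍 * 𝓔.idem 1 y w = - 𝓔.mult 1 := by
    obtain ⟨hw1, hw2⟩ := Finset.mem_erase.mp hw
    have h3 := hcom.quadratic_const hd h2 (x := y) (Finset.mem_filter.mp hw2).2
    rw [𝓔.idem_diag, ha, zero_mul, zero_mul, sub_zero, sub_zero] at h3
    rcases sq_eq_sq_iff_eq_or_eq_neg.mp h3 with h5 | h5
    · exact absurd h5.symm (hcom.card_mul_idem_one_lt hd (Ne.symm hw1)).ne
    · linarith
  have h3 : ∑ w with r y w, 𝐍 * 𝓔.idem 1 y w = 0 := by rw [← Finset.mul_sum, hsum, mul_zero]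
  rw [← Finset.add_sum_erase _ _ hy, 𝓔.idem_diag, Finset.sum_congr rfl hown, Finset.sum_const,
    nsmul_eq_mul] at h3
  have h4 : (((Finset.univ.filter (r y)).erase y).card : ℝ) = 1 :=
    mul_right_cancel₀ hm.ne' (by linarith)
  have h5 : ((Finset.univ.filter (r y)).erase y).card = 1 := by exact_mod_cast h4
  have h6 : (Finset.univ.filter (r y)).erase y = {z} := by
    obtain ⟨w, hw⟩ := Finset.card_eq_one.mp h5
    have : z ∈ (Finset.univ.filter (r y)).erase y := Finset.mem_erase.mpr ⟨hne.symm, hz⟩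
    rw [hw, Finset.mem_singleton] at this
    rw [hw, this]
  rw [← Finset.insert_erase hy, h6]

/-- If `2` is the least positive stable index, then the stable indices are the even ones and the
scheme is dual bipartite: on the components, of size two, the `E_j` with `j` odd change sign, so
that `E_1 ∘ E_j` is constant on components and has no `E_j`-component. -/
theorem IsCometric.isQBipartite (hcom : 𝓔.IsCometric) (hd : 3 ≤ d) {i : Fin (d + 1)}
    (h1 : 1 ∉ 𝓔.stable (S.graph i).Reachable) (h2 : 2 ∈ 𝓔.stable (S.graph i).Reachable) :
    𝓔.IsQBipartite := by
  classical
  have hd1 : 1 ≤ d := by omega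
  have hN := card_ne_zero S
  have hr : Equivalence (S.graph i).Reachable := SimpleGraph.reachable_is_equivalence _
  have hodd (k : ℕ) (hk : 2 * k + 1 ≤ d) : 2 * k + 1 ∉ 𝓔.stable (S.graph i).Reachable := by
    induction k with
    | zero => exact h1
    | succ k ih =>
      intro hmem
      have hq := hcom.q_sub_pos hd1 (i := 2) (j := 2 * k + 1) (by omega)
      rw [show 2 + (2 * k + 1) = 2 * (k + 1) + 1 by ring] at hq
      exact ih (by omega) (mem_stable_of_q_ne_zero h2 hmem hq.ne')
  have heven (k : ℕ) (hk : 2 * k ≤ d) : 2 * k ∈ 𝓔.stable (S.graph i).Reachable := by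
    induction k with
    | zero => exact 𝓔.zero_mem_stable _
    | succ k ih =>
      have hq := hcom.q_add_pos hd1 (i := 2) (j := 2 * k) (by omega)
      rw [show 2 + 2 * k = 2 * (k + 1) by ring] at hq
      exact mem_stable_of_q_ne_zero h2 (ih (by omega)) hq.ne'
  have hsum (j : ℕ) (hj : j ∉ 𝓔.stable (S.graph i).Reachable) (x u : X) :
      ∑ y with (S.graph i).Reachable u y, 𝓔.idem j x y = 0 := by
    have := 𝓔.sum_idem_mul_eq_zero (i := i)
      (f := fun y => if (S.graph i).Reachable u y then 1 else 0) (fun y z hyz => by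
        have : (S.graph i).Reachable u y ↔ (S.graph i).Reachable u z :=
          ⟨fun h => h.trans hyz, fun h => h.trans hyz.symm⟩
        simp only [this]) hj x
    simpa [Finset.sum_filter] using this
  have ha := hcom.q_one_one_one_eq_zero hd hr h2 (hsum 1 h1)
  intro j hj
  rw [a]
  by_contra hq
  rcases Nat.even_or_odd' j with ⟨k, rfl | rfl⟩
  · have hk := heven k hj
    exact h1 (mem_stable_of_q_ne_zero hk hk (q_ne_zero_rotate hq))
  · set j := 2 * k + 1 with hjdef
    have hk := hodd k hj
    have hflip (l : ℕ) (hl : l ∉ 𝓔.stable (S.graph i).Reachable) (x : X) {y z : X}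
        (hyz : (S.graph i).Reachable y z) (hne : y ≠ z) : 𝓔.idem l x y = - 𝓔.idem l x z := by
      have h3 := hsum l hl x y
      rw [hcom.class_eq_pair hd1 hr h2 (hsum 1 h1) ha hyz hne, Finset.sum_pair hne] at h3
      linarith
    refine 𝓔.idem_ne_zero hj (Matrix.ext fun x z => ?_)
    have h3 := 𝓔.sum_idem_mul_eq_zero (i := i) (f := fun y => 𝓔.idem 1 x y * 𝓔.idem j x y)
      (fun y z hyz => by
        by_cases hne : y = z
        · rw [hne]
        · rw [hflip 1 h1 x hyz hne, hflip j hk x hyz hne]; ring) hk z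
    have h4 := congrFun (congrFun (𝓔.hadamard_mul_idem 1 j j) x) z
    simp only [Matrix.mul_apply, Matrix.hadamard_apply, Matrix.smul_apply, smul_eq_mul] at h4
    have h5 : ∑ y, 𝓔.idem 1 x y * 𝓔.idem j x y * 𝓔.idem j y z = 0 := by
      rw [← h3]
      exact Finset.sum_congr rfl fun y _ => by rw [𝓔.idem_comm j y z]; ring
    rw [h5] at h4
    exact (mul_eq_zero.mp h4.symm).resolve_left (mul_ne_zero (inv_ne_zero hN) hq)

end IdempotentOrdering

end SymAssocScheme

end

theorem theorem3p2 {X : Type*} [Fintype X] [DecidableEq X] {d : ℕ} (S : SymAssocScheme X d)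
    (𝓔 : S.IdempotentOrdering) (himp : S.IsImprimitive) (hcom : 𝓔.IsCometric)
    (hm : 2 < 𝓔.firstMultiplicity) :
    ¬ 𝓔.IsExceptionalSix ∧ (𝓔.IsQBipartite ∨ 𝓔.IsQAntipodal) := by
  classical
  refine ⟨hcom.not_isExceptionalSix hm, ?_⟩
  obtain ⟨i, hi, hc⟩ : ∃ i, i ≠ 0 ∧ ¬ (S.graph i).Connected := by
    simpa only [SymAssocScheme.IsImprimitive, SymAssocScheme.IsPrimitive, not_forall, exists_prop]
      using himp
  have hd : 1 ≤ d := by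
    by_contra h0
    have : d = 0 := by omega
    subst this
    exact hi (Fin.ext (by omega))
  rw [𝓔.firstMultiplicity_eq hd] at hm
  obtain ⟨y, z, hyz, hr⟩ := S.exists_ne_reachable hi
  have h1 := hcom.one_notMem_stable hd hyz hr
  have hex := 𝓔.exists_mem_stable hc
  obtain ⟨ht1, htd, ht⟩ := Nat.find_spec hex
  have hmin (l : ℕ) (hl : l ∈ 𝓔.stable (S.graph i).Reachable) (hl1 : 1 ≤ l) (hld : l ≤ d) :
      Nat.find hex ≤ l := Nat.find_min' hex ⟨hl1, hld, hl⟩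
  generalize Nat.find hex = t at *
  have ht2 : t ≠ 1 := by rintro rfl; exact h1 ht
  rcases htd.eq_or_lt with rfl | hlt
  · refine Or.inr (hcom.isQAntipodal hd fun l hl => ?_)
    have hlt : l ≤ t := by
      by_contra h
      exact hl (𝓔.q_of_gt_right (by omega) _ _)
    by_contra! h0
    have := hmin l (SymAssocScheme.IdempotentOrdering.mem_stable_of_q_ne_zero ht ht hl) (by omega) hlt
    omega
  · have ha : 𝓔.q 1 t t = 0 := by
      by_contra hq
      exact h1 (SymAssocScheme.IdempotentOrdering.mem_stable_of_q_ne_zero ht ht (SymAssocScheme.IdempotentOrdering.q_ne_zero_rotate hq))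
    by_cases h2 : t = 2
    · subst h2
      exact Or.inl (hcom.isQBipartite (by omega) h1 ht)
    · refine absurd (hcom.mult_one_le_two ht1 hlt ha ?_) (not_le.mpr hm)
      by_contra hq
      have := hmin 2 (SymAssocScheme.IdempotentOrdering.mem_stable_of_q_ne_zero ht ht (SymAssocScheme.IdempotentOrdering.q_ne_zero_rotate hq)) (by omega) (by omega)
      omega
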